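/- Let $n\in\mathbb N$ and let $\mathbb T^n$ be identified with $[0,1)^n$ carrying Lebesgue measure. For $k,l\in\mathbb Z^n$ the twisted translation on $L^2(\mathbb R^{2n})$ is $$T^t_{(k,l)}\phi(x,y)=e^{\pi i(x\cdot l-y\cdot k)}\phi(x-k,y-l),\qquad x,y\in\mathbb R^n .$$ For $\phi\in L^1\cap L^2(\mathbb R^{2n})$ let $$K_\phi(\xi,\eta)=\int_{\mathbb R^n}\phi(x,\eta-\xi)\,e^{\pi i x\cdot(\xi+\eta)}\,dx$$ be the kernel of its Weyl transform; the map $\phi\mapsto K_\phi$ extends by continuity to $L^2(\mathbb R^{2n})$. For $\phi\in L^2(\mathbb R^{2n})$ let $$Z_W\phi(\xi,\xi',\eta)=\sum_{m\in\mathbb Z^n}K_\phi(m+\xi,\eta)\,e^{-2\pi i m\cdot\xi'}$$ (convergence in $L^2(\mathbb T^n\times\mathbb T^n\times\mathbb R^n)$), and let $\mathcal J\phi(\xi,\xi')\in L^2(\mathbb R^n)$ be the function $\eta\mapsto Z_W\phi(\xi,\xi',\eta)$, which is defined for a.e. $(\xi,\xi')\in\mathbb T^n\times\mathbb T^n$.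 A countable family $(v_i)_{i\in I}$ in a Hilbert space is called a frame sequence with bounds $A,B>0$ if $A\|f\|^2\le\sum_{i\in I}|\langle f,v_i\rangle|^2\le B\|f\|^2$ for every $f\in\overline{\operatorname{span}}\{v_i : i\in I\}$. Theorem. Let $\mathcal A=\{\phi_s : s\in\mathbb Z\}\subset L^2(\mathbb R^{2n})$ and let $A,B>0$. The system $E^t(\mathcal A)=\{T^t_{(k,l)}\phi_s : k,l\in\mathbb Z^n,\ s\in\mathbb Z\}$ is a frame sequence with bounds $A$ and $B$ if and only if, for a.e. $(\xi,\xi')\in\mathbb T^n\times\mathbb T^n$, the system $\{\mathcal J\phi_s(\xi,\xi') : s\in\mathbb Z\}$ is a frame sequence in $L^2(\mathbb R^n)$ with the same bounds $A$ and $B$. -/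

import Mathlib

open MeasureTheory
open scoped Topology ENNReal

namespace TwistedShift

/-- `ℝⁿ` with its Euclidean inner product and Lebesgue measure. -/
abbrev E (n : ℕ) : Type := EuclideanSpace ℝ (Fin n)

/-- The Hilbert space `L²(ℝ²ⁿ)`, with `ℝ²ⁿ` written as `ℝⁿ × ℝⁿ`. -/
abbrev L2 (n : ℕ) : Type := Lp ℂ 2 (volume : Measure (E n × E n))

/-- The Hilbert space `L²(ℝⁿ)`. -/
abbrev L2Fiber (n : ℕ) : Type := Lp ℂ 2 (volume : Measure (E n))

/-- A lattice point of `ℤⁿ`, as a vector of `ℝⁿ`. -/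
noncomputable def latt {n : ℕ} (k : Fin n → ℤ) : E n := WithLp.toLp 2 (fun i => (k i : ℝ))

/-- The cube `[0,1)ⁿ`, which represents the torus `𝕋ⁿ`. -/
def unitCube (n : ℕ) : Set (E n) := {x | ∀ i, x i ∈ Set.Ico (0 : ℝ) 1}

/-- The normalized measure of `𝕋ⁿ`: Lebesgue measure on `[0,1)ⁿ`. -/
noncomputable abbrev torusMeasure (n : ℕ) : Measure (E n) := volume.restrict (unitCube n)

/-- The measure of `𝕋ⁿ × 𝕋ⁿ`. -/
noncomputable abbrev torusMeasure₂ (n : ℕ) : Measure (E n × E n) :=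
  (torusMeasure n).prod (torusMeasure n)

/-- The measure of `𝕋ⁿ × 𝕋ⁿ × ℝⁿ`, a point being written `((ξ, ξ'), η)`. -/
noncomputable abbrev zakMeasure (n : ℕ) : Measure ((E n × E n) × E n) :=
  (torusMeasure₂ n).prod volume

/-- The character value `e^{iθ}` for real `θ`. -/
noncomputable def cis (θ : ℝ) : ℂ := Complex.exp (θ * Complex.I)

theorem norm_cis (θ : ℝ) : ‖cis θ‖ = 1 := Complex.norm_exp_ofReal_mul_I θ

theorem continuous_cis : Continuous cis := by unfold cis; fun_prop

open Classical in
/-- The class in `L²(μ)` of a square-integrable function (and `0` for any other function). -/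
noncomputable def toL2 {α : Type*} [MeasurableSpace α] (μ : Measure α) (f : α → ℂ) : Lp ℂ 2 μ :=
  if h : MemLp f 2 μ then h.toLp f else 0

/-! ### Frame sequences -/

/-- `v` is a frame sequence with bounds `A`, `B > 0`: it satisfies
`A‖f‖² ≤ ∑ᵢ |⟨f, vᵢ⟩|² ≤ B‖f‖²` for all `f` in the closed linear span of `v`. The sums of
nonnegative terms are taken in `[0, ∞]`. -/
def IsFrameSequence {H ι : Type*} [NormedAddCommGroup H] [InnerProductSpace ℂ H]
    (A B : ℝ) (v : ι → H) : Prop :=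
  0 < A ∧ 0 < B ∧ ∀ f ∈ (Submodule.span ℂ (Set.range v)).topologicalClosure,
    ENNReal.ofReal (A * ‖f‖ ^ 2) ≤ ∑' i, ENNReal.ofReal (‖inner ℂ (v i) f‖ ^ 2) ∧
    ∑' i, ENNReal.ofReal (‖inner ℂ (v i) f‖ ^ 2) ≤ ENNReal.ofReal (B * ‖f‖ ^ 2)

/-! ### Twisted translations -/

theorem memLp_twistedTranslate {n : ℕ} (k l : Fin n → ℤ) (φ : L2 n) :
    MemLp (fun p : E n × E n =>
      cis (Real.pi * (inner ℝ p.1 (latt l) - inner ℝ p.2 (latt k))) *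
        φ (p.1 - latt k, p.2 - latt l)) 2 volume := by
  have hmp : MeasurePreserving (fun p : E n × E n => (p.1 - latt k, p.2 - latt l))
      volume volume :=
    (measurePreserving_sub_right volume (latt k : E n)).prod
      (measurePreserving_sub_right volume (latt l : E n))
  have h := (Lp.memLp φ).comp_measurePreserving hmp
  refine h.of_le ?_ (Filter.Eventually.of_forall fun p => ?_)
  · refine AEStronglyMeasurable.mul (Continuous.aestronglyMeasurable ?_) h.1
    exact continuous_cis.comp (by fun_prop)
  · simp [norm_cis]

/-- The twisted translation
`T_{(k,l)} φ(x, y) = e^{πi(x·l - y·k)} φ(x - k, y - l)` on `L²(ℝ²ⁿ)`. -/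
noncomputable def twistedTranslate {n : ℕ} (k l : Fin n → ℤ) (φ : L2 n) : L2 n :=
  (memLp_twistedTranslate k l φ).toLp _

/-- The system `{T_{(k,l)} φ_s : k, l ∈ ℤⁿ, s ∈ ℤ}`. -/
noncomputable def twistedSystem {n : ℕ} (φ : ℤ → L2 n) :
    (Fin n → ℤ) × (Fin n → ℤ) × ℤ → L2 n :=
  fun q => twistedTranslate q.1 q.2.1 (φ q.2.2)

/-! ### The kernel of the Weyl transform -/

/-- `K_g(ξ, η) = ∫ g(x, η - ξ) e^{πi x·(ξ + η)} dx`, the kernel of the Weyl transform of an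
integrable function `g`. -/
noncomputable def weylKernelFun {n : ℕ} (g : E n × E n → ℂ) : E n × E n → ℂ :=
  fun p => ∫ x : E n, g (x, p.2 - p.1) * cis (Real.pi * inner ℝ x (p.1 + p.2))

/-- The kernel `K_φ` for `φ ∈ L²(ℝ²ⁿ)`: the continuous extension to `L²(ℝ²ⁿ)` of the map
`g ↦ K_g` on the dense subspace `L¹ ∩ L²`, that is, the limit in `L²(ℝ²ⁿ)` of `K_g` as
`g ∈ L¹ ∩ L²` tends to `φ` in `L²(ℝ²ⁿ)`. It exists since `‖K_g‖₂ = ‖g‖₂` for such `g`. -/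
noncomputable def weylKernel {n : ℕ} (φ : L2 n) : L2 n :=
  Filter.limUnder (𝓝[{g : L2 n | Integrable g volume}] φ)
    (fun g => toL2 volume (weylKernelFun (g : E n × E n → ℂ)))

/-! ### The Weyl-Zak transform and the fiber map -/

theorem volume_unitCube (n : ℕ) : volume (unitCube n) = 1 := by
  have hs : unitCube n = (MeasurableEquiv.toLp 2 (Fin n → ℝ)).symm ⁻¹'
      (Set.univ.pi fun _ => Set.Ico (0 : ℝ) 1) := by
    ext x; simp [unitCube, Set.mem_pi]
  rw [hs, (EuclideanSpace.volume_preserving_symm_measurableEquiv_toLp (Fin n)).measure_preimage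
    (MeasurableSet.univ_pi fun _ => measurableSet_Ico).nullMeasurableSet, volume_pi_pi]
  simp

theorem memLp_zakTerm {n : ℕ} (K : L2 n) (m : Fin n → ℤ) :
    MemLp (fun z : (E n × E n) × E n =>
      K (latt m + z.1.1, z.2) * cis (-(2 * Real.pi * inner ℝ (latt m) z.1.2))) 2
      (zakMeasure n) := by
  have : IsProbabilityMeasure (torusMeasure n) :=
    ⟨by rw [Measure.restrict_apply_univ, volume_unitCube]⟩
  have h1 : MemLp (fun p : E n × E n => K (latt m + p.1, p.2)) 2
      ((torusMeasure n).prod volume) := by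
    have hmp : MeasurePreserving (fun p : E n × E n => (latt m + p.1, p.2)) volume volume :=
      (measurePreserving_add_left volume (latt m : E n)).prod (MeasurePreserving.id volume)
    have h := (Lp.memLp K).comp_measurePreserving hmp
    exact h.mono_measure (Measure.prod_mono Measure.restrict_le_self le_rfl)
  have hmp : MeasurePreserving (fun z : (E n × E n) × E n => (z.1.1, z.2)) (zakMeasure n)
      ((torusMeasure n).prod volume) :=
    (measurePreserving_fst (μ := torusMeasure n) (ν := torusMeasure n)).prod
      (MeasurePreserving.id volume)
  have h := h1.comp_measurePreserving hmp
  refine h.of_le ?_ (Filter.Eventually.of_forall fun p => ?_)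
  · refine AEStronglyMeasurable.mul h.1 (Continuous.aestronglyMeasurable ?_)
    exact continuous_cis.comp (by fun_prop)
  · simp [norm_cis]

/-- The `m`-th term `K(m + ξ, η) e^{-2πi m·ξ'}` of the Zak series, in `L²(𝕋ⁿ × 𝕋ⁿ × ℝⁿ)`. -/
noncomputable def zakTerm {n : ℕ} (K : L2 n) (m : Fin n → ℤ) : Lp ℂ 2 (zakMeasure n) :=
  (memLp_zakTerm K m).toLp _

/-- The Weyl-Zak transform
`Z_W φ(ξ, ξ', η) = ∑_{m ∈ ℤⁿ} K_φ(m + ξ, η) e^{-2πi m·ξ'}`. The series consists of pairwise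
orthogonal terms and converges in `L²(𝕋ⁿ × 𝕋ⁿ × ℝⁿ)`. -/
noncomputable def weylZak {n : ℕ} (φ : L2 n) : Lp ℂ 2 (zakMeasure n) :=
  ∑' m : Fin n → ℤ, zakTerm (weylKernel φ) m

/-- The fiber `𝒥φ(ξ, ξ') ∈ L²(ℝⁿ)`, the class of `η ↦ Z_W φ(ξ, ξ', η)`; by Fubini this function
is square-integrable for almost every `(ξ, ξ')`. -/
noncomputable def fiberMap {n : ℕ} (φ : L2 n) (z : E n × E n) : L2Fiber n :=
  toL2 volume (fun η => weylZak φ (z, η))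

end TwistedShift

/-! The proof is a fiberization. Up to a change of variables of determinant one, the Weyl transform
is a partial inverse Fourier transform, so Plancherel makes `weylKernel` an isometry; it turns
`T_{(k,l)}` into `K ↦ e^{πi k·l} e^{2πi k·ξ} K(ξ + l, η)`. The Zak transform is again an isometry,
because cubes tile `ℝⁿ` and characters are orthogonal, and it turns this shift into multiplication
by `e^{πi k·l} e^{2πi(k·ξ + l·ξ')}`. Hence the twisted system becomes the family of all modulations,
by characters of the base torus and harmless constant phases, of the generators `Z_W φ_s`.

For such a family Parseval on the base gives `∑ |⟨F, f⟩|² = ∫ ∑_s |⟨G_s(z), f(z)⟩|² dz`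
(`tsum_enorm_sq_inner`), while `‖f‖² = ∫ ‖f(z)‖² dz`. Fiberwise inequalities therefore integrate to
the global ones. Conversely, the closed span of the modulations contains the cut-offs `1_D f` of
combinations `f` of the generators (`mem_topologicalClosure`), so the global inequalities hold on
every measurable `D` and thus almost everywhere (`frameIneq_fiber`). A countable dense set of
coefficients makes the exceptional null set independent of the vector
(`isFrameSequence_iff_fibers`). -/

namespace TwistedShift

/-! ### Parseval on the torus for integrable functions. -/

section TorusFourier

open Filter Set UnitAddTorus
open scoped ComplexConjugate

/-- An integrable function which is orthogonal to all continuous functions vanishes. -/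
theorem ae_eq_zero_of_forall_integral_continuous_mul {X : Type*} [PseudoEMetricSpace X]
    [CompactSpace X] [MeasurableSpace X] [BorelSpace X] {μ : Measure X} {g : X → ℂ}
    (hg : Integrable g μ) (h : ∀ q : C(X, ℂ), ∫ x, q x * g x ∂μ = 0) : g =ᵐ[μ] 0 := by
  refine ae_eq_zero_of_forall_setIntegral_isClosed_eq_zero hg fun s hs => ?_
  rw [← integral_indicator hs.measurableSet]
  -- The approximating sequence of the closed set `s` is continuous, bounded by 1, and converges
  -- pointwise to its indicator.
  have hlim : Tendsto (fun N => ∫ x, ((hs.apprSeq N x : NNReal) : ℂ) * g x ∂μ) atTop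
      (𝓝 (∫ x, s.indicator g x ∂μ)) := by
    refine tendsto_integral_of_dominated_convergence (fun x => ‖g x‖) (fun N => ?_) hg.norm
      (fun N => Eventually.of_forall fun x => ?_) (Eventually.of_forall fun x => ?_)
    · refine AEStronglyMeasurable.mul (Continuous.aestronglyMeasurable ?_) hg.1
      exact Complex.continuous_ofReal.comp (NNReal.continuous_coe.comp (hs.apprSeq N).continuous)
    · rw [norm_mul]
      refine mul_le_of_le_one_left (norm_nonneg _) ?_
      have := HasOuterApproxClosed.apprSeq_apply_le_one hs N x
      simpa using this
    · have h1 := (tendsto_pi_nhds.1 (HasOuterApproxClosed.tendsto_apprSeq hs)) x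
      have h2 : Tendsto (fun N => ((hs.apprSeq N x : NNReal) : ℂ)) atTop
          (𝓝 ((s.indicator (fun _ => (1 : NNReal)) x : NNReal) : ℂ)) :=
        (Complex.continuous_ofReal.tendsto _).comp ((NNReal.continuous_coe.tendsto _).comp h1)
      convert h2.mul_const (g x) using 2
      by_cases hx : x ∈ s <;> simp [hx]
  refine tendsto_nhds_unique hlim ?_
  have : ∀ N, ∫ x, ((hs.apprSeq N x : NNReal) : ℂ) * g x ∂μ = 0 := fun N =>
    h ⟨fun x => ((hs.apprSeq N x : NNReal) : ℂ),
      Complex.continuous_ofReal.comp (NNReal.continuous_coe.comp (hs.apprSeq N).continuous)⟩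
  simp [this]

noncomputable local instance : MeasureSpace UnitAddCircle := ⟨AddCircle.haarAddCircle⟩

local instance : IsProbabilityMeasure (volume : Measure UnitAddCircle) :=
  inferInstanceAs (IsProbabilityMeasure AddCircle.haarAddCircle)

variable {d : Type*} [Fintype d]

/-- Pairing with an integrable `g` is continuous in the sup norm, and trigonometric polynomials are
uniformly dense. The Hilbert basis alone does not suffice, since `g` need not be square-integrable.
-/
theorem ae_eq_zero_of_mFourierCoeff_eq_zero {g : UnitAddTorus d → ℂ} (hg : Integrable g)
    (h : ∀ k, mFourierCoeff g k = 0) : g =ᵐ[volume] 0 := by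
  refine ae_eq_zero_of_forall_integral_continuous_mul hg fun q => ?_
  have hint : ∀ q : C(UnitAddTorus d, ℂ), Integrable (fun x => q x * g x) := fun q =>
    hg.bdd_mul (c := ‖q‖) q.continuous.aestronglyMeasurable
      (Eventually.of_forall fun x => q.norm_coe_le_norm x)
  have hcont : Continuous fun q : C(UnitAddTorus d, ℂ) => ∫ x, q x * g x := by
    refine continuous_iff_continuousAt.2 fun q₀ => ?_
    refine continuousAt_of_dominated (bound := fun x => (‖q₀‖ + 1) * ‖g x‖)
      (Eventually.of_forall fun q => (hint q).1) ?_ (hg.norm.const_mul _)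
      (Eventually.of_forall fun x => ?_)
    · filter_upwards [Metric.ball_mem_nhds q₀ one_pos] with q hq
      refine Eventually.of_forall fun x => ?_
      rw [norm_mul]
      refine mul_le_mul_of_nonneg_right ((q.norm_coe_le_norm x).trans ?_) (norm_nonneg _)
      have h1 := norm_add_le (q - q₀) q₀
      rw [Metric.mem_ball, dist_eq_norm] at hq
      rw [sub_add_cancel] at h1
      linarith
    · exact ((continuous_eval_const x).mul continuous_const).continuousAt
  have hcl : IsClosed {q : C(UnitAddTorus d, ℂ) | ∫ x, q x * g x = 0} :=
    isClosed_eq hcont continuous_const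
  have hq : q ∈ (Submodule.span ℂ (range <| mFourier (d := d))).topologicalClosure := by
    rw [span_mFourier_closure_eq_top]; trivial
  refine closure_minimal (fun p hp => ?_) hcl hq
  induction hp using Submodule.span_induction with
  | mem p hp =>
    obtain ⟨k, rfl⟩ := hp
    simpa [mFourierCoeff] using h (-k)
  | zero => simp
  | add p p' _ _ hp hp' =>
    simp only [mem_ofPred_eq, ContinuousMap.add_apply, add_mul] at *
    rw [integral_add (hint p) (hint p'), hp, hp', add_zero]
  | smul c p _ hp =>
    simp only [mem_ofPred_eq, ContinuousMap.smul_apply, smul_eq_mul, mul_assoc] at *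
    rw [integral_const_mul, hp, mul_zero]

/-- Parseval's identity for integrable functions on the torus, both sides being possibly
infinite. -/
theorem tsum_enorm_sq_mFourierCoeff {g : UnitAddTorus d → ℂ} (hg : Integrable g) :
    ∑' k, ‖mFourierCoeff g k‖ₑ ^ 2 = ∫⁻ x, ‖g x‖ₑ ^ 2 := by
  have hcongr : ∀ {f f' : UnitAddTorus d → ℂ}, f =ᵐ[volume] f' →
      mFourierCoeff f = mFourierCoeff f' := fun h => funext fun k =>
    integral_congr_ae (h.mono fun x hx => by simp only [hx])
  have hL2 : ∀ f : UnitAddTorus d → ℂ, MemLp f 2 →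
      ∑' k, ‖mFourierCoeff f k‖ₑ ^ 2 = ∫⁻ x, ‖f x‖ₑ ^ 2 := by
    intro f hf
    have h := hasSum_sq_mFourierCoeff (hf.toLp f)
    rw [hcongr hf.coeFn_toLp,
      integral_congr_ae (g := fun x => ‖f x‖ ^ 2) (hf.coeFn_toLp.mono fun x hx => by
        simp only [hx])] at h
    have h1 := ENNReal.ofReal_tsum_of_nonneg (fun k => sq_nonneg ‖mFourierCoeff f k‖) h.summable
    rw [h.tsum_eq, ofReal_integral_eq_lintegral_ofReal hf.integrable_norm_pow'
      (Eventually.of_forall fun x => sq_nonneg _)] at h1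
    simp only [ENNReal.ofReal_pow (norm_nonneg _), ofReal_norm] at h1
    exact h1.symm
  -- If `g` is not in `L²`, the integral is infinite. Were the sum finite, Riesz–Fischer would give
  -- an `L²` function `f` with the same coefficients, and uniqueness of coefficients in `L¹` would
  -- force `g = f` a.e.
  by_cases hmem : MemLp g 2
  · exact hL2 g hmem
  have htop : ∫⁻ x, ‖g x‖ₑ ^ 2 = ∞ := by
    by_contra hne
    refine hmem ((memLp_two_iff_integrable_sq_norm hg.1).2 ⟨(hg.1.norm.pow 2), ?_⟩)
    simpa [HasFiniteIntegral, lt_top_iff_ne_top, enorm_pow] using hne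
  rw [htop]
  by_contra hne
  refine hmem ?_
  have hsum : Summable fun k => ‖mFourierCoeff g k‖ ^ 2 := by
    have h2 := ENNReal.summable_toReal hne
    simpa [ENNReal.toReal_pow, toReal_enorm] using h2
  let c : lp (fun _ : d → ℤ => ℂ) 2 := ⟨mFourierCoeff g, by
    refine memℓp_gen ?_
    simpa using hsum⟩
  let f := mFourierBasis.repr.symm c
  have hf : mFourierCoeff f = mFourierCoeff g := by
    funext k
    rw [← mFourierBasis_repr f k]
    simp [f, c]
  have hfL := Lp.memLp f
  have hfi : Integrable f := hfL.integrable (by norm_num)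
  have hz := ae_eq_zero_of_mFourierCoeff_eq_zero (hg.sub hfi) fun k => by
    have hb : ∀ u : UnitAddTorus d → ℂ, Integrable u →
        Integrable fun x => mFourier (-k) x • u x := fun u hu =>
      hu.bdd_mul (c := ‖mFourier (-k)‖) (mFourier (-k)).continuous.aestronglyMeasurable
        (Eventually.of_forall fun x => (mFourier (-k)).norm_coe_le_norm x)
    have : mFourierCoeff (g - (f : UnitAddTorus d → ℂ)) k = mFourierCoeff g k - mFourierCoeff f k := by
      simp only [mFourierCoeff, Pi.sub_apply, smul_sub]
      exact integral_sub (hb g hg) (hb f hfi)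
    rw [this, hf, sub_self]
  refine hfL.ae_eq (hz.mono fun x hx => ?_)
  simp only [Pi.sub_apply, Pi.zero_apply, sub_eq_zero] at hx
  exact hx.symm

/-- The representative in `[0,1)` of a point of the circle. -/
noncomputable def circleRep (x : UnitAddCircle) : ℝ := (AddCircle.equivIco 1 0 x : ℝ)

theorem measurePreserving_circleRep :
    MeasurePreserving circleRep volume (volume.restrict (Ico (0 : ℝ) 1)) := by
  have hm : Measurable circleRep :=
    measurable_subtype_coe.comp (AddCircle.measurableEquivIco 1 0).measurable
  refine ⟨hm, ?_⟩
  have hmk := AddCircle.measurePreserving_mk 1 (0 : ℝ)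
  -- For period 1 the quotient Lebesgue measure has mass 1, so it is the normalized Haar measure
  -- chosen above as `volume`.
  have hvol : (volume : Measure UnitAddCircle) = @volume _ (AddCircle.measureSpace 1) := by
    rw [AddCircle.volume_eq_smul_haarAddCircle]; simp; rfl
  rw [hvol, ← hmk.map_eq, Measure.map_map hm hmk.measurable, zero_add,
    ← Measure.restrict_congr_set (Ico_ae_eq_Ioc (α := ℝ) (a := 0) (b := 1))]
  conv_rhs => rw [← Measure.map_id (μ := volume.restrict (Ico (0 : ℝ) 1))]
  refine Measure.map_congr ?_
  filter_upwards [ae_restrict_mem measurableSet_Ico] with x hx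
  simp only [Function.comp_apply, circleRep, id]
  rw [AddCircle.equivIco_coe_eq (by simpa using hx)]

theorem fourier_eq_cis_circleRep (k : ℤ) (x : UnitAddCircle) :
    fourier k x = cis (2 * Real.pi * (k * circleRep x)) := by
  have hx : ((circleRep x : ℝ) : UnitAddCircle) = x := AddCircle.coe_equivIco
  conv_lhs => rw [← hx]
  rw [fourier_coe_apply, cis]
  congr 1
  push_cast
  ring

variable {n : ℕ}

/-- The representative in `[0,1)ⁿ` of a point of the torus. -/
noncomputable def cubeRep (x : UnitAddTorus (Fin n)) : E n :=
  WithLp.toLp 2 fun i => circleRep (x i)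

theorem restrict_unitCube_eq_map : torusMeasure n =
    Measure.map (MeasurableEquiv.toLp 2 (Fin n → ℝ))
      (Measure.pi fun _ : Fin n => volume.restrict (Ico (0 : ℝ) 1)) := by
  have h := (EuclideanSpace.volume_preserving_symm_measurableEquiv_toLp (Fin n)).symm
  have hpre : (univ.pi fun _ : Fin n => Ico (0 : ℝ) 1) =
      (MeasurableEquiv.toLp 2 (Fin n → ℝ)) ⁻¹' unitCube n := by
    ext x; simp [unitCube, Set.mem_pi]
  rw [← Measure.restrict_pi_pi, hpre, ← volume_pi]
  exact (h.restrict_preimage_emb (MeasurableEquiv.measurableEmbedding _) _).map_eq.symm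

theorem measurePreserving_cubeRep :
    MeasurePreserving (cubeRep (n := n)) volume (torusMeasure n) := by
  have h1 : MeasurePreserving (fun (x : UnitAddTorus (Fin n)) i => circleRep (x i)) volume
      (Measure.pi fun _ : Fin n => volume.restrict (Ico (0 : ℝ) 1)) :=
    measurePreserving_pi _ _ fun _ => measurePreserving_circleRep
  exact MeasurePreserving.comp ⟨(MeasurableEquiv.toLp 2 (Fin n → ℝ)).measurable,
    restrict_unitCube_eq_map.symm⟩ h1

instance isProbabilityMeasure_torusMeasure : IsProbabilityMeasure (torusMeasure n) :=
  ⟨by rw [Measure.restrict_apply_univ, volume_unitCube]⟩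

/-- The representative in `[0,1)ⁿ × [0,1)ⁿ` of a point of the torus. -/
noncomputable def cubeRep₂ (x : UnitAddTorus (Fin n ⊕ Fin n)) : E n × E n :=
  (cubeRep fun i => x (Sum.inl i), cubeRep fun i => x (Sum.inr i))

theorem measurePreserving_cubeRep₂ :
    MeasurePreserving (cubeRep₂ (n := n)) volume (torusMeasure₂ n) :=
  (measurePreserving_cubeRep.prod measurePreserving_cubeRep).comp
    (volume_measurePreserving_sumPiEquivProdPi fun _ : Fin n ⊕ Fin n => UnitAddCircle)

/-- The character `(ξ, ξ') ↦ e^{2πi(k·ξ + l·ξ')}` of `𝕋ⁿ × 𝕋ⁿ`. -/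
noncomputable def char₂ (q : (Fin n → ℤ) × (Fin n → ℤ)) (z : E n × E n) : ℂ :=
  cis (2 * Real.pi * (inner ℝ (latt q.1) z.1 + inner ℝ (latt q.2) z.2))

theorem norm_char₂ (q : (Fin n → ℤ) × (Fin n → ℤ)) (z : E n × E n) : ‖char₂ q z‖ = 1 :=
  norm_cis _

theorem continuous_char₂ (q : (Fin n → ℤ) × (Fin n → ℤ)) : Continuous (char₂ q) :=
  continuous_cis.comp (by fun_prop)

theorem cis_add (a b : ℝ) : cis (a + b) = cis a * cis b := by
  simp [cis, add_mul, Complex.exp_add]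

theorem cis_neg (a : ℝ) : cis (-a) = conj (cis a) := by
  simp [cis, ← Complex.exp_conj]

theorem cis_sum {ι : Type*} (s : Finset ι) (f : ι → ℝ) :
    cis (∑ i ∈ s, f i) = ∏ i ∈ s, cis (f i) := by
  simp [cis, Finset.sum_mul, Complex.exp_sum]

theorem char₂_cubeRep₂ (q : (Fin n → ℤ) × (Fin n → ℤ)) (x : UnitAddTorus (Fin n ⊕ Fin n)) :
    char₂ q (cubeRep₂ x) = mFourier (Sum.elim q.1 q.2) x := by
  simp only [char₂, mFourier, ContinuousMap.coe_mk, fourier_eq_cis_circleRep, ← cis_sum,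
    ← Finset.mul_sum]
  simp [PiLp.inner_apply, latt, cubeRep₂, cubeRep, mul_comm]

/-- Parseval's identity on `𝕋ⁿ × 𝕋ⁿ`. -/
theorem tsum_enorm_sq_integral_char₂ {g : E n × E n → ℂ} (hg : Integrable g (torusMeasure₂ n)) :
    ∑' q, ‖∫ z, conj (char₂ q z) * g z ∂(torusMeasure₂ n)‖ₑ ^ 2 =
      ∫⁻ z, ‖g z‖ₑ ^ 2 ∂(torusMeasure₂ n) := by
  have hmp := measurePreserving_cubeRep₂ (n := n)
  have hg' : Integrable (g ∘ cubeRep₂) := hmp.integrable_comp_of_integrable hg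
  have hR : ∫⁻ z, ‖g z‖ₑ ^ 2 ∂(torusMeasure₂ n) =
      ∫⁻ x : UnitAddTorus (Fin n ⊕ Fin n), ‖(g ∘ cubeRep₂) x‖ₑ ^ 2 := by
    rw [← hmp.map_eq, lintegral_map' (by rw [hmp.map_eq]; exact hg.1.enorm.pow_const 2)
      hmp.aemeasurable]
    rfl
  rw [hR, ← tsum_enorm_sq_mFourierCoeff hg',
    ← (Equiv.sumArrowEquivProdArrow (Fin n) (Fin n) ℤ).symm.tsum_eq]
  refine tsum_congr fun q => ?_
  congr 2
  have hmeas : AEStronglyMeasurable (fun z => conj (char₂ q z) * g z) (torusMeasure₂ n) :=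
    ((Complex.continuous_conj.comp (continuous_char₂ q)).aestronglyMeasurable).mul hg.1
  rw [← hmp.map_eq, integral_map hmp.aemeasurable (by rwa [hmp.map_eq]), mFourierCoeff]
  refine integral_congr_ae (Eventually.of_forall fun x => ?_)
  simp only [char₂_cubeRep₂, mFourier_neg, smul_eq_mul, Function.comp_apply]
  rfl

/-- The nontrivial characters of `𝕋ⁿ` have mean zero. -/
theorem integral_cis_latt {m : Fin n → ℤ} (hm : m ≠ 0) :
    ∫ x, cis (2 * Real.pi * inner ℝ (latt m) x) ∂(torusMeasure n) = 0 := by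
  have hmp := measurePreserving_cubeRep (n := n)
  have hc : Continuous fun x : E n => cis (2 * Real.pi * inner ℝ (latt m) x) :=
    continuous_cis.comp (by fun_prop)
  rw [← hmp.map_eq, integral_map hmp.aemeasurable hc.aestronglyMeasurable]
  have h : inner ℂ (mFourierLp 2 (0 : Fin n → ℤ)) (mFourierLp 2 m) = 0 :=
    orthonormal_mFourier.2 hm.symm
  rw [ContinuousMap.inner_toLp] at h
  rw [← h]
  refine integral_congr_ae (Eventually.of_forall fun x => ?_)
  simp only [mFourier_zero, ContinuousMap.one_apply, map_one, mul_one]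
  simp only [mFourier, ContinuousMap.coe_mk, fourier_eq_cis_circleRep, ← cis_sum, ← Finset.mul_sum]
  simp [PiLp.inner_apply, latt, cubeRep, mul_comm]

end TorusFourier

/-! ### Fibers of square-integrable functions on a product. -/

section Fibers

open Filter
open scoped ComplexConjugate

variable {X Y : Type*} [MeasurableSpace X] [MeasurableSpace Y] {μ : Measure X} {ν : Measure Y}

theorem toL2_eq_toLp {f : Y → ℂ} (hf : MemLp f 2 ν) : toL2 ν f = hf.toLp f := dif_pos hf

theorem toL2_congr {f g : Y → ℂ} (h : f =ᵐ[ν] g) : toL2 ν f = toL2 ν g := by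
  by_cases hf : MemLp f 2 ν
  · rw [toL2_eq_toLp hf, toL2_eq_toLp (hf.ae_eq h)]
    exact (MemLp.toLp_eq_toLp_iff _ _).2 h
  · rw [toL2, toL2, dif_neg hf, dif_neg fun hg => hf (hg.ae_eq h.symm)]

theorem toL2_sum {ι : Type*} (J : Finset ι) (c : ι → ℂ) {g : ι → Y → ℂ}
    (hg : ∀ s ∈ J, MemLp (g s) 2 ν) :
    toL2 ν (fun y => ∑ s ∈ J, c s * g s y) = ∑ s ∈ J, c s • toL2 ν (g s) := by
  classical
  induction J using Finset.induction_on with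
  | empty =>
    have h0 : MemLp (fun _ : Y => (0 : ℂ)) 2 ν := MemLp.zero
    simp only [Finset.sum_empty]
    rw [toL2_eq_toLp h0]
    exact MemLp.toLp_zero h0
  | insert a J ha ih =>
    have h1 : MemLp (c a • g a) 2 ν := (hg a (Finset.mem_insert_self a J)).const_smul (c a)
    have h2 : MemLp (fun y => ∑ s ∈ J, c s * g s y) 2 ν :=
      memLp_finsetSum J fun s hs => (hg s (Finset.mem_insert_of_mem hs)).const_mul (c s)
    rw [Finset.sum_insert ha, ← ih fun s hs => hg s (Finset.mem_insert_of_mem hs),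
      toL2_eq_toLp h2, toL2_eq_toLp (hg a (Finset.mem_insert_self a J)), ← MemLp.toLp_const_smul,
      ← MemLp.toLp_add h1 h2, ← toL2_eq_toLp]
    refine toL2_congr (Eventually.of_forall fun y => ?_)
    simp [Finset.sum_insert ha]

theorem enorm_sq_toL2 {f : Y → ℂ} (hf : MemLp f 2 ν) :
    ‖toL2 ν f‖ₑ ^ 2 = ∫⁻ y, ‖f y‖ₑ ^ 2 ∂ν := by
  rw [toL2_eq_toLp hf, Lp.enorm_def, eLpNorm_congr_ae hf.coeFn_toLp,
    eLpNorm_eq_lintegral_rpow_enorm_toReal (by norm_num) (by norm_num), ← ENNReal.rpow_natCast,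
    ← ENNReal.rpow_mul]
  simp

theorem enorm_sq_eq_lintegral (f : Lp ℂ 2 ν) : ‖f‖ₑ ^ 2 = ∫⁻ y, ‖f y‖ₑ ^ 2 ∂ν := by
  rw [← enorm_sq_toL2 (Lp.memLp f), toL2_eq_toLp (Lp.memLp f), Lp.toLp_coeFn]

theorem inner_toL2 {f g : Y → ℂ} (hf : MemLp f 2 ν) (hg : MemLp g 2 ν) :
    inner ℂ (toL2 ν f) (toL2 ν g) = ∫ y, conj (f y) * g y ∂ν := by
  rw [toL2_eq_toLp hf, toL2_eq_toLp hg, L2.inner_def]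
  refine integral_congr_ae ?_
  filter_upwards [hf.coeFn_toLp, hg.coeFn_toLp] with y h1 h2
  rw [h1, h2, RCLike.inner_apply, mul_comm]

theorem integrable_conj_mul (f g : Lp ℂ 2 ν) : Integrable (fun y => conj (f y) * g y) ν := by
  refine (L2.integrable_inner f g (𝕜 := ℂ)).congr (Eventually.of_forall fun y => ?_)
  simp [RCLike.inner_apply, mul_comm]

/-- The fiber over `z` of a square-integrable function on a product. -/
noncomputable def fiber (ν : Measure Y) (f : X × Y → ℂ) (z : X) : Lp ℂ 2 ν :=
  toL2 ν fun y => f (z, y)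

variable [SFinite ν] [SFinite μ]

theorem ae_memLp_fiber {f : X × Y → ℂ} (hf : MemLp f 2 (μ.prod ν)) :
    ∀ᵐ z ∂μ, MemLp (fun y => f (z, y)) 2 ν := by
  have h2 := (memLp_two_iff_integrable_sq_norm hf.1).1 hf
  filter_upwards [hf.1.prodMk_left, h2.prod_right_ae] with z h3 h4
  exact (memLp_two_iff_integrable_sq_norm h3).2 h4

/-- `toL2` takes the value 0 outside `L²`, so fibers depend linearly on the function only at the
base points, almost all by Fubini, where every summand has a square-integrable section. -/
theorem fiber_sum {ι : Type*} (J : Finset ι) (c : ι → X → ℂ) {f : X × Y → ℂ} {g : ι → X × Y → ℂ}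
    (hg : ∀ s ∈ J, MemLp (g s) 2 (μ.prod ν))
    (hf : f =ᵐ[μ.prod ν] fun p => ∑ s ∈ J, c s p.1 * g s p) :
    ∀ᵐ z ∂μ, fiber ν f z = ∑ s ∈ J, c s z • fiber ν (g s) z := by
  have h1 : ∀ᵐ z ∂μ, ∀ s ∈ J, MemLp (fun y => g s (z, y)) 2 ν :=
    (ae_ball_iff J.countable_toSet).2 fun s hs => ae_memLp_fiber (hg s hs)
  filter_upwards [h1, Measure.ae_ae_of_ae_prod hf] with z hz hfz
  rw [fiber, toL2_congr hfz, toL2_sum J (fun s => c s z) hz]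
  rfl

theorem fiber_mul (c : X → ℂ) {f g : X × Y → ℂ} (hg : MemLp g 2 (μ.prod ν))
    (hf : f =ᵐ[μ.prod ν] fun p => c p.1 * g p) :
    ∀ᵐ z ∂μ, fiber ν f z = c z • fiber ν g z := by
  simpa using fiber_sum (μ := μ) ({()} : Finset Unit) (fun _ => c) (g := fun _ => g)
    (fun _ _ => hg) (by simpa using hf)

theorem aemeasurable_enorm_sq_fiber (f : Lp ℂ 2 (μ.prod ν)) :
    AEMeasurable (fun z => ‖fiber ν f z‖ₑ ^ 2) μ := by
  refine ((Lp.memLp f).1.enorm.pow_const 2).lintegral_prod_right'.congr ?_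
  filter_upwards [ae_memLp_fiber (Lp.memLp f)] with z hz
  exact (enorm_sq_toL2 hz).symm

theorem lintegral_enorm_sq_fiber (f : Lp ℂ 2 (μ.prod ν)) :
    ∫⁻ z, ‖fiber ν f z‖ₑ ^ 2 ∂μ = ‖f‖ₑ ^ 2 := by
  rw [enorm_sq_eq_lintegral, lintegral_prod _ ((Lp.memLp f).1.enorm.pow_const 2)]
  refine lintegral_congr_ae ?_
  filter_upwards [ae_memLp_fiber (Lp.memLp f)] with z hz
  exact enorm_sq_toL2 hz

theorem inner_fiber_ae_eq (f g : Lp ℂ 2 (μ.prod ν)) :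
    (fun z => inner ℂ (fiber ν f z) (fiber ν g z)) =ᵐ[μ]
      fun z => ∫ y, conj (f (z, y)) * g (z, y) ∂ν := by
  filter_upwards [ae_memLp_fiber (Lp.memLp f), ae_memLp_fiber (Lp.memLp g)] with z h1 h2
  exact inner_toL2 h1 h2

theorem integrable_inner_fiber (f g : Lp ℂ 2 (μ.prod ν)) :
    Integrable (fun z => inner ℂ (fiber ν f z) (fiber ν g z)) μ :=
  (integrable_conj_mul f g).integral_prod_left.congr (inner_fiber_ae_eq f g).symm

theorem integral_inner_fiber (f g : Lp ℂ 2 (μ.prod ν)) :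
    ∫ z, inner ℂ (fiber ν f z) (fiber ν g z) ∂μ = inner ℂ f g := by
  rw [integral_congr_ae (inner_fiber_ae_eq f g), L2.inner_def,
    ← integral_prod _ (integrable_conj_mul f g)]
  refine integral_congr_ae (Eventually.of_forall fun y => ?_)
  simp [RCLike.inner_apply, mul_comm]

end Fibers

/-! ### Frame inequalities: density and transport. -/

section Frames

open Filter Set

variable {H ι : Type*} [NormedAddCommGroup H] [InnerProductSpace ℂ H]

/-- The two frame inequalities for a single vector. -/
def FrameIneq (A B : ℝ) (v : ι → H) (f : H) : Prop :=
  ENNReal.ofReal A * ‖f‖ₑ ^ 2 ≤ ∑' i, ‖inner ℂ (v i) f‖ₑ ^ 2 ∧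
    ∑' i, ‖inner ℂ (v i) f‖ₑ ^ 2 ≤ ENNReal.ofReal B * ‖f‖ₑ ^ 2

theorem isFrameSequence_iff {A B : ℝ} {v : ι → H} :
    IsFrameSequence A B v ↔ 0 < A ∧ 0 < B ∧
      ∀ f ∈ (Submodule.span ℂ (range v)).topologicalClosure, FrameIneq A B v f := by
  refine and_congr_right fun hA => and_congr_right fun hB => forall₂_congr fun f _ => ?_
  simp only [FrameIneq, ENNReal.ofReal_mul hA.le, ENNReal.ofReal_mul hB.le,
    ENNReal.ofReal_pow (norm_nonneg _), ofReal_norm]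

/-- The full sum is the supremum of finite sums, each continuous in `f`, so the set is an
intersection of closed sets. The lower frame inequality has no such direct argument. -/
theorem isClosed_bessel (b : ℝ≥0∞) (hb : b ≠ ∞) (v : ι → H) :
    IsClosed {f : H | ∑' i, ‖inner ℂ (v i) f‖ₑ ^ 2 ≤ b * ‖f‖ₑ ^ 2} := by
  simp only [ENNReal.tsum_eq_iSup_sum, iSup_le_iff, ofPred_forall]
  refine isClosed_iInter fun J => isClosed_le ?_ ?_
  · refine continuous_finsetSum _ fun i _ => (ENNReal.continuous_pow 2).comp ?_
    exact continuous_enorm.comp (by fun_prop)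
  · exact (ENNReal.continuous_const_mul hb).comp ((ENNReal.continuous_pow 2).comp continuous_enorm)

/-- Minkowski's inequality for counting measure; with values in `[0, ∞]` it needs no summability. -/
theorem rpow_half_tsum_add_le (a b : ι → ℂ) :
    (∑' i, ‖a i + b i‖ₑ ^ 2) ^ (1 / 2 : ℝ) ≤
      (∑' i, ‖a i‖ₑ ^ 2) ^ (1 / 2 : ℝ) + (∑' i, ‖b i‖ₑ ^ 2) ^ (1 / 2 : ℝ) := by
  let _ : MeasurableSpace ι := ⊤
  have key : ∀ c : ι → ℂ, (∑' i, ‖c i‖ₑ ^ 2) ^ (1 / 2 : ℝ) = eLpNorm c 2 Measure.count := by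
    intro c
    rw [eLpNorm_eq_lintegral_rpow_enorm_toReal (by norm_num) (by norm_num), lintegral_count]
    simp
  have hm : ∀ c : ι → ℂ, AEStronglyMeasurable c Measure.count := fun c =>
    (measurable_from_top (f := c)).aestronglyMeasurable
  simp only [key]
  exact eLpNorm_add_le (hm a) (hm b) (by norm_num)

/-- The frame inequalities extend from a dense subset to the closed span. -/
theorem isFrameSequence_iff_of_dense {A B : ℝ} {v : ι → H} {S : Set H}
    (hS : S ⊆ (Submodule.span ℂ (range v)).topologicalClosure)
    (hS' : (Submodule.span ℂ (range v) : Set H) ⊆ closure S) :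
    IsFrameSequence A B v ↔ 0 < A ∧ 0 < B ∧ ∀ f ∈ S, FrameIneq A B v f := by
  rw [isFrameSequence_iff]
  refine and_congr_right fun hA => and_congr_right fun hB =>
    ⟨fun h f hf => h f (hS hf), fun h => ?_⟩
  set V := (Submodule.span ℂ (range v)).topologicalClosure
  have hV : (V : Set H) ⊆ closure S := closure_minimal hS' isClosed_closure
  have hup : ∀ f ∈ V, ∑' i, ‖inner ℂ (v i) f‖ₑ ^ 2 ≤ ENNReal.ofReal B * ‖f‖ₑ ^ 2 := fun f hf =>
    closure_minimal (fun g hg => (h g hg).2) (isClosed_bessel _ ENNReal.ofReal_ne_top v) (hV hf)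
  intro f hf
  refine ⟨?_, hup f hf⟩
  obtain ⟨g, hgS, hg⟩ := mem_closure_iff_seq_limit.1 (hV hf)
  have hsq : ∀ (c x : ℝ≥0∞), (c * x ^ 2) ^ (1 / 2 : ℝ) = c ^ (1 / 2 : ℝ) * x := by
    intro c x
    rw [ENNReal.mul_rpow_of_nonneg _ _ (by norm_num), ← ENNReal.rpow_natCast, ← ENNReal.rpow_mul]
    norm_num
  have hmono : Monotone fun x : ℝ≥0∞ => x ^ (1 / 2 : ℝ) := fun x y hxy =>
    ENNReal.rpow_le_rpow hxy (by norm_num)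
  -- The lower bound for `g k` passes to `f` by Minkowski, the error `g k - f` being controlled by
  -- the upper bound already proved on the whole closed span.
  have hle : ∀ k, ENNReal.ofReal A ^ (1 / 2 : ℝ) * ‖g k‖ₑ ≤
      (∑' i, ‖inner ℂ (v i) f‖ₑ ^ 2) ^ (1 / 2 : ℝ) +
        ENNReal.ofReal B ^ (1 / 2 : ℝ) * ‖g k - f‖ₑ := by
    intro k
    have h1 := hmono (h (g k) (hgS k)).1
    have h2 := hmono (hup (g k - f) (V.sub_mem (hS (hgS k)) hf))
    simp only [hsq] at h1 h2
    have h3 := rpow_half_tsum_add_le (fun i => inner ℂ (v i) f) fun i => inner ℂ (v i) (g k - f)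
    simp only [← inner_add_right, add_sub_cancel] at h3
    exact h1.trans (h3.trans (add_le_add le_rfl h2))
  have hfin : ∀ x : ℝ, ENNReal.ofReal x ^ (1 / 2 : ℝ) ≠ ∞ := fun x =>
    ENNReal.rpow_ne_top_of_nonneg (by norm_num) ENNReal.ofReal_ne_top
  have hlim1 : Tendsto (fun k => ENNReal.ofReal A ^ (1 / 2 : ℝ) * ‖g k‖ₑ) atTop
      (𝓝 (ENNReal.ofReal A ^ (1 / 2 : ℝ) * ‖f‖ₑ)) :=
    ENNReal.Tendsto.const_mul ((continuous_enorm.tendsto f).comp hg) (Or.inr (hfin A))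
  have hlim2 : Tendsto (fun k => (∑' i, ‖inner ℂ (v i) f‖ₑ ^ 2) ^ (1 / 2 : ℝ) +
        ENNReal.ofReal B ^ (1 / 2 : ℝ) * ‖g k - f‖ₑ) atTop
      (𝓝 ((∑' i, ‖inner ℂ (v i) f‖ₑ ^ 2) ^ (1 / 2 : ℝ) +
        ENNReal.ofReal B ^ (1 / 2 : ℝ) * ‖f - f‖ₑ)) :=
    tendsto_const_nhds.add (ENNReal.Tendsto.const_mul
      ((continuous_enorm.tendsto (f - f)).comp (hg.sub_const f)) (Or.inr (hfin B)))
  have hfinal := le_of_tendsto_of_tendsto' hlim1 hlim2 hle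
  rw [sub_self, enorm_zero, mul_zero, add_zero, ← hsq] at hfinal
  exact (ENNReal.rpow_le_rpow_iff (by norm_num)).1 hfinal

theorem isFrameSequence_iff_span {A B : ℝ} {v : ι → H} :
    IsFrameSequence A B v ↔ 0 < A ∧ 0 < B ∧
      ∀ f ∈ Submodule.span ℂ (range v), FrameIneq A B v f :=
  isFrameSequence_iff_of_dense (Submodule.le_topologicalClosure _) subset_closure

theorem isFrameSequence_comp_linearIsometry {H' : Type*} [NormedAddCommGroup H']
    [InnerProductSpace ℂ H'] {A B : ℝ} {v : ι → H} (W : H →ₗᵢ[ℂ] H') :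
    IsFrameSequence A B (fun i => W (v i)) ↔ IsFrameSequence A B v := by
  have hspan : Submodule.span ℂ (range fun i => W (v i)) =
      (Submodule.span ℂ (range v)).map W.toLinearMap := by
    rw [Submodule.map_span, ← range_comp]; rfl
  rw [isFrameSequence_iff_span, isFrameSequence_iff_span, hspan]
  refine and_congr_right fun _ => and_congr_right fun _ => ?_
  simp only [Submodule.mem_map, forall_exists_index, and_imp, forall_apply_eq_imp_iff₂]
  refine forall₂_congr fun f _ => ?_
  simp [FrameIneq, W.inner_map_map, enorm_eq_nnnorm]

theorem isFrameSequence_comp_equiv {κ : Type*} {A B : ℝ} {v : ι → H} (e : κ ≃ ι) :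
    IsFrameSequence A B (fun i => v (e i)) ↔ IsFrameSequence A B v := by
  have hr : range (fun i => v (e i)) = range v := e.surjective.range_comp v
  rw [isFrameSequence_iff_span, isFrameSequence_iff_span, hr]
  refine and_congr_right fun _ => and_congr_right fun _ => forall₂_congr fun f _ => ?_
  rw [FrameIneq, FrameIneq, e.tsum_eq fun i => ‖inner ℂ (v i) f‖ₑ ^ 2]

/-- Finite combinations with coefficients in a dense set of sequences are dense in the span. -/
theorem span_subset_closure_combinations {D : Set (ι → ℂ)} (hD : Dense D) (v : ι → H) :
    (Submodule.span ℂ (range v) : Set H) ⊆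
      closure {f | ∃ J : Finset ι, ∃ c ∈ D, f = ∑ s ∈ J, c s • v s} := by
  intro f hf
  obtain ⟨c, rfl⟩ := (Finsupp.mem_span_range_iff_exists_finsupp).1 hf
  -- With the finite support fixed, only finitely many coordinates of `b` enter, so the product
  -- topology suffices.
  have hcont : Continuous fun b : ι → ℂ => ∑ s ∈ c.support, b s • v s := by fun_prop
  refine closure_mono ?_ (hcont.range_subset_closure_image_dense hD ⟨c, rfl⟩)
  rintro _ ⟨b, hb, rfl⟩
  exact ⟨c.support, b, hb, rfl⟩

end Frames

/-! ### Modulation systems and their fibers. -/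

section FiberFrames

open Filter Set
open scoped ComplexConjugate

variable {X Y Λ : Type*} [MeasurableSpace X] [MeasurableSpace Y] {μ : Measure X} {ν : Measure Y}
  [IsProbabilityMeasure μ] [SFinite ν] {e : Λ → X → ℂ} {u : Λ → ℂ}
  {G : ℤ → Lp ℂ 2 (μ.prod ν)} {F : Λ × ℤ → Lp ℂ 2 (μ.prod ν)}

/-- `F` consists of the modulations of `G` by a system of characters satisfying Parseval's
identity. -/
structure IsModulationSystem (e : Λ → X → ℂ) (u : Λ → ℂ) (G : ℤ → Lp ℂ 2 (μ.prod ν))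
    (F : Λ × ℤ → Lp ℂ 2 (μ.prod ν)) : Prop where
  norm_phase : ∀ q, ‖u q‖ = 1
  -- Integrability is all that is available later: `g` will be a fiberwise inner product of two `L²`
  -- functions.
  parseval : ∀ g : X → ℂ, Integrable g μ →
    ∑' q, ‖∫ z, conj (e q z) * g z ∂μ‖ₑ ^ 2 = ∫⁻ z, ‖g z‖ₑ ^ 2 ∂μ
  ae_eq : ∀ q s, F (q, s) =ᵐ[μ.prod ν] fun p => (u q * e q p.1) * G s p

namespace IsModulationSystem

theorem fiber_ae_eq (h : IsModulationSystem e u G F) (q : Λ) (s : ℤ) :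
    ∀ᵐ z ∂μ, fiber ν (F (q, s)) z = (u q * e q z) • fiber ν (G s) z :=
  fiber_mul (fun z => u q * e q z) (Lp.memLp _) (h.ae_eq q s)

/-- The global inner product is the integral of the fiberwise ones; hence, up to a unimodular
factor, it is a Fourier coefficient of `z ↦ ⟨G_s(z), f(z)⟩`. -/
theorem enorm_inner (h : IsModulationSystem e u G F) (q : Λ) (s : ℤ) (f : Lp ℂ 2 (μ.prod ν)) :
    ‖inner ℂ (F (q, s)) f‖ₑ =
      ‖∫ z, conj (e q z) * inner ℂ (fiber ν (G s) z) (fiber ν f z) ∂μ‖ₑ := by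
  have hu : ‖conj (u q)‖ₑ = 1 := by
    rw [← ofReal_norm, RCLike.norm_conj, h.norm_phase q, ENNReal.ofReal_one]
  rw [← one_mul ‖∫ z, _ ∂μ‖ₑ, ← hu, ← enorm_mul, ← integral_const_mul, ← integral_inner_fiber]
  congr 1
  refine integral_congr_ae ?_
  filter_upwards [h.fiber_ae_eq q s] with z hz
  rw [hz, inner_smul_left, map_mul, mul_assoc]

theorem tsum_enorm_sq_inner_modulation (h : IsModulationSystem e u G F) (s : ℤ)
    (f : Lp ℂ 2 (μ.prod ν)) :
    ∑' q, ‖inner ℂ (F (q, s)) f‖ₑ ^ 2 =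
      ∫⁻ z, ‖inner ℂ (fiber ν (G s) z) (fiber ν f z)‖ₑ ^ 2 ∂μ := by
  simp only [h.enorm_inner]
  exact h.parseval _ (integrable_inner_fiber _ _)

theorem tsum_enorm_sq_inner (h : IsModulationSystem e u G F) (f : Lp ℂ 2 (μ.prod ν)) :
    ∑' i, ‖inner ℂ (F i) f‖ₑ ^ 2 =
      ∫⁻ z, ∑' s, ‖inner ℂ (fiber ν (G s) z) (fiber ν f z)‖ₑ ^ 2 ∂μ := by
  rw [lintegral_tsum fun s => (integrable_inner_fiber (G s) f).1.enorm.pow_const 2,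
    ENNReal.tsum_prod', ENNReal.tsum_comm]
  exact tsum_congr fun s => h.tsum_enorm_sq_inner_modulation s f

/-- The algebraic span suffices because `isFrameSequence_iff_span` removes closures on both levels.
-/
theorem fiber_mem_span (h : IsModulationSystem e u G F) {f : Lp ℂ 2 (μ.prod ν)}
    (hf : f ∈ Submodule.span ℂ (range F)) :
    ∀ᵐ z ∂μ, fiber ν f z ∈ Submodule.span ℂ (range fun s => fiber ν (G s) z) := by
  induction hf using Submodule.span_induction with
  | mem f hf =>
    obtain ⟨⟨q, s⟩, rfl⟩ := hf
    filter_upwards [h.fiber_ae_eq q s] with z hz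
    rw [hz]
    exact Submodule.smul_mem _ _ (Submodule.subset_span ⟨s, rfl⟩)
  | zero =>
    have h0 := fiber_sum (μ := μ) (ν := ν) (∅ : Finset Unit) (fun _ _ => 0) (g := fun _ _ => 0)
      (by simp) (f := (0 : Lp ℂ 2 (μ.prod ν))) ((Lp.coeFn_zero _ _ _).trans (by simp; rfl))
    filter_upwards [h0] with z hz
    rw [hz]
    simp
  | add f g _ _ hf hg =>
    have h1 := fiber_sum (μ := μ) (ν := ν) (Finset.univ : Finset Bool) (fun _ _ => 1)
      (g := fun b => if b then f else g) (fun b _ => by cases b <;> exact Lp.memLp _)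
      (f := (f + g : Lp ℂ 2 (μ.prod ν))) ((Lp.coeFn_add f g).trans (by simp; rfl))
    filter_upwards [h1, hf, hg] with z hz hfz hgz
    rw [hz]
    simpa using Submodule.add_mem _ hfz hgz
  | smul c f _ hf =>
    have h1 := fiber_mul (μ := μ) (ν := ν) (fun _ => c) (Lp.memLp f)
      (f := (c • f : Lp ℂ 2 (μ.prod ν))) (Lp.coeFn_smul c f)
    filter_upwards [h1, hf] with z hz hfz
    rw [hz]
    exact Submodule.smul_mem _ _ hfz

theorem isFrameSequence_of_fibers (h : IsModulationSystem e u G F) {A B : ℝ}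
    (hz : ∀ᵐ z ∂μ, IsFrameSequence A B fun s => fiber ν (G s) z) : IsFrameSequence A B F := by
  -- The base has mass 1, so some good fiber exists; it supplies the positivity of `A` and `B`.
  obtain ⟨z₀, hz₀⟩ := hz.exists
  refine isFrameSequence_iff_span.2 ⟨hz₀.1, hz₀.2.1, fun f hf => ?_⟩
  have hae : ∀ᵐ z ∂μ, FrameIneq A B (fun s => fiber ν (G s) z) (fiber ν f z) := by
    filter_upwards [hz, h.fiber_mem_span hf] with z h1 h2
    exact (isFrameSequence_iff_span.1 h1).2.2 _ h2
  rw [FrameIneq, h.tsum_enorm_sq_inner, ← lintegral_enorm_sq_fiber,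
    ← lintegral_const_mul'' _ (aemeasurable_enorm_sq_fiber f),
    ← lintegral_const_mul'' _ (aemeasurable_enorm_sq_fiber f)]
  exact ⟨lintegral_mono_ae (hae.mono fun z hz => hz.1),
    lintegral_mono_ae (hae.mono fun z hz => hz.2)⟩

/-- Restricting a combination of the generators to a set of base points stays in the closed
span of the modulations. -/
theorem mem_topologicalClosure (h : IsModulationSystem e u G F) {f : Lp ℂ 2 (μ.prod ν)}
    (J : Finset ℤ) (c : ℤ → X → ℂ)
    (hf : ∀ᵐ z ∂μ, fiber ν f z = ∑ s ∈ J, c s z • fiber ν (G s) z) :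
    f ∈ (Submodule.span ℂ (range F)).topologicalClosure := by
  -- The closed span is the double orthogonal complement. If `g` is orthogonal to all modulations of
  -- `G s`, Parseval makes `⟨G_s(z), g(z)⟩` vanish a.e., so `g` is orthogonal to `f`. The
  -- coefficients `c` need be neither bounded nor measurable.
  rw [← Submodule.orthogonal_orthogonal_eq_closure, Submodule.mem_orthogonal']
  intro g hg
  have hzero : ∀ᵐ z ∂μ, ∀ s, inner ℂ (fiber ν (G s) z) (fiber ν g z) = 0 := by
    refine ae_all_iff.2 fun s => ?_
    have h1 := h.tsum_enorm_sq_inner_modulation s g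
    have h2 : ∀ q, inner ℂ (F (q, s)) g = 0 := fun q =>
      hg (F (q, s)) (Submodule.subset_span ⟨(q, s), rfl⟩)
    simp only [h2, enorm_zero, ne_eq, OfNat.ofNat_ne_zero, not_false_eq_true, zero_pow,
      tsum_zero] at h1
    have h3 := (lintegral_eq_zero_iff'
      ((integrable_inner_fiber (G s) g).1.enorm.pow_const 2)).1 h1.symm
    filter_upwards [h3] with z hz
    simpa using hz
  rw [← integral_inner_fiber, integral_eq_zero_of_ae]
  filter_upwards [hf, hzero] with z h1 h2
  rw [h1, sum_inner]
  exact Finset.sum_eq_zero fun s _ => by rw [inner_smul_left, h2, mul_zero]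

/-- Localization: the global inequalities for `1_D f`, with `D` arbitrary, compare integrals over
every measurable `D`, which is an a.e. comparison of the integrands. -/
theorem frameIneq_fiber (h : IsModulationSystem e u G F) {A B : ℝ} (hF : IsFrameSequence A B F)
    (J : Finset ℤ) (c : ℤ → ℂ) :
    ∀ᵐ z ∂μ, FrameIneq A B (fun s => fiber ν (G s) z) (∑ s ∈ J, c s • fiber ν (G s) z) := by
  set f : Lp ℂ 2 (μ.prod ν) := ∑ s ∈ J, c s • G s with hfdef
  have hf : f =ᵐ[μ.prod ν] fun p => ∑ s ∈ J, c s * G s p := by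
    have h1 := Lp.coeFn_finsetSum J fun s => c s • G s
    have h2 : ∀ᵐ p ∂(μ.prod ν), ∀ s ∈ J, (c s • G s : Lp ℂ 2 (μ.prod ν)) p = c s * G s p :=
      (ae_ball_iff J.countable_toSet).2 fun s _ => Lp.coeFn_smul (c s) (G s)
    filter_upwards [h1, h2] with p h1 h2
    rw [hfdef, h1, Finset.sum_apply]
    exact Finset.sum_congr rfl h2
  have hfib : ∀ᵐ z ∂μ, fiber ν f z = ∑ s ∈ J, c s • fiber ν (G s) z :=
    fiber_sum J (fun s _ => c s) (fun s _ => Lp.memLp (G s)) hf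
  set S : X → ℝ≥0∞ := fun z => ∑' s, ‖inner ℂ (fiber ν (G s) z) (fiber ν f z)‖ₑ ^ 2 with hS
  have hSm : AEMeasurable S μ := AEMeasurable.tsum fun s =>
    (integrable_inner_fiber (G s) f).1.enorm.pow_const 2
  have hNm := aemeasurable_enorm_sq_fiber f
  have key : ∀ D : Set X, MeasurableSet D →
      ENNReal.ofReal A * ∫⁻ z in D, ‖fiber ν f z‖ₑ ^ 2 ∂μ ≤ ∫⁻ z in D, S z ∂μ ∧
        ∫⁻ z in D, S z ∂μ ≤ ENNReal.ofReal B * ∫⁻ z in D, ‖fiber ν f z‖ₑ ^ 2 ∂μ := by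
    intro D hD
    have hmem : MemLp ((D ×ˢ (univ : Set Y)).indicator f) 2 (μ.prod ν) :=
      (Lp.memLp f).indicator (hD.prod MeasurableSet.univ)
    set fD : Lp ℂ 2 (μ.prod ν) := hmem.toLp _
    have hfD : ∀ᵐ z ∂μ, fiber ν fD z = D.indicator (fun _ => (1 : ℂ)) z • fiber ν f z := by
      refine fiber_mul _ (Lp.memLp f) (hmem.coeFn_toLp.trans (Eventually.of_forall fun p => ?_))
      by_cases hp : p.1 ∈ D <;> simp [indicator, hp]
    have hin := (isFrameSequence_iff.1 hF).2.2 fD (h.mem_topologicalClosure J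
      (fun s z => D.indicator (fun _ => (1 : ℂ)) z * c s) (by
        filter_upwards [hfD, hfib] with z h1 h2
        rw [h1, h2, Finset.smul_sum]
        simp only [smul_smul]))
    have e1 : ∫⁻ z, ‖fiber ν fD z‖ₑ ^ 2 ∂μ = ∫⁻ z in D, ‖fiber ν f z‖ₑ ^ 2 ∂μ := by
      rw [← lintegral_indicator hD]
      refine lintegral_congr_ae ?_
      filter_upwards [hfD] with z hz
      by_cases hzD : z ∈ D <;> simp [hz, hzD]
    have e2 : ∫⁻ z, ∑' s, ‖inner ℂ (fiber ν (G s) z) (fiber ν fD z)‖ₑ ^ 2 ∂μ =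
        ∫⁻ z in D, S z ∂μ := by
      rw [← lintegral_indicator hD]
      refine lintegral_congr_ae ?_
      filter_upwards [hfD] with z hz
      by_cases hzD : z ∈ D <;> simp [hz, hzD, hS]
    rwa [FrameIneq, h.tsum_enorm_sq_inner, ← lintegral_enorm_sq_fiber, e1, e2] at hin
  have hlow : ∀ᵐ z ∂μ, ENNReal.ofReal A * ‖fiber ν f z‖ₑ ^ 2 ≤ S z := by
    refine ae_le_of_forall_setLIntegral_le_of_sigmaFinite₀ (hNm.const_mul _) fun D hD _ => ?_
    rw [lintegral_const_mul'' _ hNm.restrict]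
    exact (key D hD).1
  have hupp : ∀ᵐ z ∂μ, S z ≤ ENNReal.ofReal B * ‖fiber ν f z‖ₑ ^ 2 := by
    refine ae_le_of_forall_setLIntegral_le_of_sigmaFinite₀ hSm fun D hD _ => ?_
    rw [lintegral_const_mul'' _ hNm.restrict]
    exact (key D hD).2
  filter_upwards [hfib, hlow, hupp] with z h1 h2 h3
  rw [← h1]
  exact ⟨h2, h3⟩

/-- A modulation system is a frame sequence iff almost all fibers of its generators are. -/
theorem isFrameSequence_iff_fibers (h : IsModulationSystem e u G F) {A B : ℝ} :
    IsFrameSequence A B F ↔ ∀ᵐ z ∂μ, IsFrameSequence A B fun s => fiber ν (G s) z := by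
  refine ⟨fun hF => ?_, h.isFrameSequence_of_fibers⟩
  -- The null set in `frameIneq_fiber` depends on `J` and `c`; countably many choices allow one null
  -- set for all.
  obtain ⟨D, hDc, hD⟩ := TopologicalSpace.exists_countable_dense (ℤ → ℂ)
  have hall : ∀ᵐ z ∂μ, ∀ J : Finset ℤ, ∀ c ∈ D,
      FrameIneq A B (fun s => fiber ν (G s) z) (∑ s ∈ J, c s • fiber ν (G s) z) :=
    ae_all_iff.2 fun J => (ae_ball_iff hDc).2 fun c _ => h.frameIneq_fiber hF J c
  filter_upwards [hall] with z hz
  refine (isFrameSequence_iff_of_dense ?_ (span_subset_closure_combinations hD _)).2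
    ⟨hF.1, hF.2.1, ?_⟩
  · rintro _ ⟨J, c, _, rfl⟩
    exact Submodule.le_topologicalClosure _ (Submodule.sum_mem _ fun s _ =>
      Submodule.smul_mem _ _ (Submodule.subset_span ⟨s, rfl⟩))
  · rintro _ ⟨J, c, hc, rfl⟩
    exact hz J c hc

end IsModulationSystem

end FiberFrames

/-! ### Plancherel for the Fourier integral on `L¹ ∩ L²`. -/

section Plancherel

open Filter Set FourierTransform
open scoped SchwartzMap ContDiff RealInnerProductSpace

variable {V : Type*} [NormedAddCommGroup V] [InnerProductSpace ℝ V] [FiniteDimensional ℝ V]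
  [MeasurableSpace V] [BorelSpace V]

theorem continuous_fourier_of_integrable {f : V → ℂ} (hf : Integrable f) : Continuous (𝓕 f) :=
  VectorFourier.fourierIntegral_continuous Real.continuous_fourierChar
    (by exact continuous_inner) hf

/-- On `L¹ ∩ L²` the Fourier transform of `L²` is given by the Fourier integral. -/
theorem fourier_toLp_ae_eq {f : V → ℂ} (hf : Integrable f) (hf2 : MemLp f 2) :
    (𝓕 (hf2.toLp f) : Lp ℂ 2 (volume : Measure V)) =ᵐ[volume] 𝓕 f := by
  refine ae_eq_of_integral_contDiff_smul_eq
    ((Lp.memLp _).locallyIntegrable (by norm_num))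
    (continuous_fourier_of_integrable hf).locallyIntegrable fun g hg hgc => ?_
  -- Both transforms satisfy `∫ 𝓕ψ · f = ∫ ψ · 𝓕f`: the `L²` one through tempered distributions, the
  -- integral one by Fubini. They agree against all test functions.
  let ψ : 𝓢(V, ℂ) := HasCompactSupport.toSchwartzMap (f := fun x => (g x : ℂ))
    (hgc.comp_left Complex.ofReal_zero) (Complex.ofRealCLM.contDiff.comp hg)
  have h1 := congrArg (fun T : 𝓢'(V, ℂ) => T ψ) (Lp.fourier_toTemperedDistribution_eq (hf2.toLp f))
  simp only [TemperedDistribution.fourier_apply, Lp.toTemperedDistribution_apply] at h1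
  have h2 : ∫ x, (𝓕 ψ) x • (hf2.toLp f) x = ∫ x, (𝓕 (ψ : V → ℂ)) x • f x := by
    refine integral_congr_ae ?_
    filter_upwards [hf2.coeFn_toLp] with x hx
    rw [hx, SchwartzMap.fourier_coe]
  have h3 : ∫ x, (𝓕 (ψ : V → ℂ)) x • f x = ∫ x, ψ x • 𝓕 f x := by
    have := VectorFourier.integral_fourierIntegral_smul_eq_flip (L := innerₗ V) (μ := volume)
      (ν := volume) Real.continuous_fourierChar (by exact continuous_inner) ψ.integrable hf
    rwa [flip_innerₗ] at this
  rw [h2, h3] at h1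
  exact h1.symm

/-- Plancherel's theorem on `L¹ ∩ L²`. -/
theorem lintegral_enorm_sq_fourierInv {f : V → ℂ} (hf : Integrable f) (hf2 : MemLp f 2) :
    ∫⁻ s, ‖𝓕⁻ f s‖ₑ ^ 2 = ∫⁻ x, ‖f x‖ₑ ^ 2 := by
  have h1 : ‖𝓕 (hf2.toLp f)‖ₑ ^ 2 = ‖hf2.toLp f‖ₑ ^ 2 := by
    rw [← ofReal_norm, Lp.norm_fourier_eq, ofReal_norm]
  rw [enorm_sq_eq_lintegral, enorm_sq_eq_lintegral] at h1
  simp only [Real.fourierInv_eq_fourier_neg]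
  rw [lintegral_neg_eq_self (μ := volume) (fun s => ‖𝓕 f s‖ₑ ^ 2)]
  calc _ = ∫⁻ x, ‖(𝓕 (hf2.toLp f) : Lp ℂ 2 (volume : Measure V)) x‖ₑ ^ 2 :=
        lintegral_congr_ae ((fourier_toLp_ae_eq hf hf2).mono fun x hx => by simp only [hx])
    _ = _ := h1
    _ = _ := lintegral_congr_ae (hf2.coeFn_toLp.mono fun x hx => by simp only [hx])

end Plancherel

/-! ### Unimodular multipliers and density of `L¹ ∩ L²`. -/

section Multiplication

open Filter

variable {Z : Type*} [MeasurableSpace Z] {μ : Measure Z}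

theorem memLp_mul_of_norm_eq_one {c f : Z → ℂ} (hc : AEStronglyMeasurable c μ)
    (hc1 : ∀ z, ‖c z‖ = 1) (hf : MemLp f 2 μ) : MemLp (fun z => c z * f z) 2 μ :=
  hf.of_le (hc.mul hf.1) (Eventually.of_forall fun z => by simp [hc1])

/-- Multiplication by a unimodular function, as an isometry of `L²`. -/
noncomputable def mulLI (c : Z → ℂ) (hc : AEStronglyMeasurable c μ) (hc1 : ∀ z, ‖c z‖ = 1) :
    Lp ℂ 2 μ →ₗᵢ[ℂ] Lp ℂ 2 μ where
  toFun f := (memLp_mul_of_norm_eq_one hc hc1 (Lp.memLp f)).toLp _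
  map_add' f g := by
    rw [← MemLp.toLp_add, MemLp.toLp_eq_toLp_iff]
    filter_upwards [Lp.coeFn_add f g] with z hz
    rw [hz, Pi.add_apply, Pi.add_apply, mul_add]
  map_smul' a f := by
    rw [RingHom.id_apply, ← MemLp.toLp_const_smul, MemLp.toLp_eq_toLp_iff]
    filter_upwards [Lp.coeFn_smul a f] with z hz
    simp [hz, mul_left_comm]
  norm_map' f := by
    change ‖(memLp_mul_of_norm_eq_one hc hc1 (Lp.memLp f)).toLp _‖ = _
    rw [Lp.norm_toLp, Lp.norm_def]
    congr 1
    refine eLpNorm_congr_norm_ae (Eventually.of_forall fun z => ?_)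
    simp [hc1]

theorem coeFn_mulLI (c : Z → ℂ) (hc : AEStronglyMeasurable c μ) (hc1 : ∀ z, ‖c z‖ = 1)
    (f : Lp ℂ 2 μ) : mulLI c hc hc1 f =ᵐ[μ] fun z => c z * f z :=
  MemLp.coeFn_toLp (memLp_mul_of_norm_eq_one hc hc1 (Lp.memLp f))

/-- Simple functions are dense in `L²`, and a square-integrable simple function has support of
finite measure. -/
theorem dense_integrable : Dense {g : Lp ℂ 2 μ | Integrable g μ} := by
  refine (Lp.simpleFunc.dense (E := ℂ) (μ := μ) (p := 2) (by norm_num)).mono fun f hf => ?_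
  let f' : Lp.simpleFunc ℂ 2 μ := ⟨f, hf⟩
  have h1 := Lp.simpleFunc.toSimpleFunc_eq_toFun f'
  have h2 := Lp.simpleFunc.memLp f'
  exact ((SimpleFunc.memLp_iff_integrable (by norm_num) (by norm_num)).1 h2).congr h1

end Multiplication

/-! ### The Weyl kernel as an isometry. -/

section WeylKernel

open Filter Set FourierTransform
open scoped RealInnerProductSpace

variable {n : ℕ}

/-- The measure-preserving change of variables `(ξ, η) ↦ ((ξ + η) / 2, η - ξ)`. -/
noncomputable def weylCoord (p : E n × E n) : E n × E n :=
  ((1 / 2 : ℝ) • (p.1 + p.2), p.2 - p.1)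

theorem measurePreserving_weylCoord :
    MeasurePreserving (weylCoord (n := n)) volume volume := by
  -- Factorization into shears and swaps: with `w = η - ξ`, the path is `(ξ, η) ↦ (ξ, w) ↦ (w, ξ) ↦
  -- (w, w/2 + ξ) ↦ (w/2 + ξ, w)`, and `w/2 + ξ = (ξ + η)/2`.
  have h1 : MeasurePreserving (fun p : E n × E n => (p.1, -p.1 + p.2)) volume volume :=
    measurePreserving_prod_neg_add volume volume
  have h2 : MeasurePreserving (fun p : E n × E n => (p.1, (1 / 2 : ℝ) • p.1 + p.2))
      volume volume :=
    (MeasurePreserving.id volume).skew_product (by fun_prop)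
      (Eventually.of_forall fun w => (measurePreserving_add_left volume ((1 / 2 : ℝ) • w)).map_eq)
  have h3 : MeasurePreserving (Prod.swap : E n × E n → E n × E n) volume volume :=
    Measure.measurePreserving_swap
  have h := h3.comp (h2.comp (h3.comp h1))
  convert h using 1
  funext p
  simp only [weylCoord, Function.comp_apply, Prod.swap, Prod.mk.injEq]
  refine ⟨?_, by abel⟩
  module

theorem ae_sub_of_ae {P : E n → Prop} (h : ∀ᵐ w, P w) :
    ∀ᵐ p : E n × E n, P (p.2 - p.1) :=
  ((Measure.quasiMeasurePreserving_snd (μ := (volume : Measure (E n)))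
    (ν := (volume : Measure (E n)))).comp
      measurePreserving_weylCoord.quasiMeasurePreserving).ae h

/-- The phase `πx·(ξ + η)` is `2πx·s` at the midpoint `s = (ξ + η)/2`. -/
theorem weylKernelFun_eq_fourierInv (g : E n × E n → ℂ) (p : E n × E n) :
    weylKernelFun g p = 𝓕⁻ (fun x => g (x, (weylCoord p).2)) (weylCoord p).1 := by
  rw [Real.fourierInv_eq', weylKernelFun]
  refine integral_congr_ae (Eventually.of_forall fun x => ?_)
  simp only [weylCoord, cis, smul_eq_mul, inner_smul_right]
  rw [mul_comm]
  congr 3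
  push_cast
  ring

theorem ae_ae_swap {P : E n × E n → Prop} (h : ∀ᵐ p, P p) : ∀ᵐ w, ∀ᵐ x, P (x, w) :=
  Measure.ae_ae_of_ae_prod
    (((Measure.measurePreserving_swap (μ := (volume : Measure (E n)))
      (ν := (volume : Measure (E n)))).quasiMeasurePreserving).ae h)

theorem weylKernelFun_congr {g g' : E n × E n → ℂ} (h : g =ᵐ[volume] g') :
    weylKernelFun g =ᵐ[volume] weylKernelFun g' := by
  filter_upwards [ae_sub_of_ae (ae_ae_swap h)] with p hp
  exact integral_congr_ae (hp.mono fun x hx => by simp only [hx])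

theorem stronglyMeasurable_weylKernelFun (g : L2 n) :
    StronglyMeasurable (weylKernelFun (g : E n × E n → ℂ)) := by
  have hg := Lp.stronglyMeasurable g
  have h1 : StronglyMeasurable fun q : (E n × E n) × E n =>
      (g : E n × E n → ℂ) (q.2, q.1.2 - q.1.1) * cis (Real.pi * inner ℝ q.2 (q.1.1 + q.1.2)) :=
    (hg.comp_measurable (by fun_prop)).mul
      (continuous_cis.comp (by fun_prop)).stronglyMeasurable
  exact h1.integral_prod_right

theorem ae_integrable_section {g : L2 n} (hg : Integrable g) :
    ∀ᵐ w, Integrable fun x => (g : E n × E n → ℂ) (x, w) :=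
  hg.prod_left_ae

theorem ae_memLp_section (g : L2 n) :
    ∀ᵐ w, MemLp (fun x => (g : E n × E n → ℂ) (x, w)) 2 :=
  ae_memLp_fiber (f := fun p : E n × E n => (g : E n × E n → ℂ) p.swap)
    ((Lp.memLp g).comp_measurePreserving (Measure.measurePreserving_swap))

/-- The inverse Fourier transform in the first variable. -/
noncomputable def partialFourierInv (g : E n × E n → ℂ) (q : E n × E n) : ℂ :=
  𝓕⁻ (fun x => g (x, q.2)) q.1

theorem measurable_partialFourierInv {g : E n × E n → ℂ} (hg : StronglyMeasurable g) :
    Measurable (partialFourierInv g) := by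
  have h0 : Continuous fun q : (E n × E n) × E n =>
      Complex.exp (((2 * Real.pi * inner ℝ q.2 q.1.1 : ℝ) : ℂ) * Complex.I) := by fun_prop
  have hk : StronglyMeasurable fun q : (E n × E n) × E n =>
      Complex.exp (((2 * Real.pi * inner ℝ q.2 q.1.1 : ℝ) : ℂ) * Complex.I) • g (q.2, q.1.2) :=
    h0.stronglyMeasurable.smul
      (hg.comp_measurable (g := fun q : (E n × E n) × E n => (q.2, q.1.2)) (by fun_prop))
  have h1 : partialFourierInv g = fun q : E n × E n => ∫ x : E n,
      Complex.exp (((2 * Real.pi * inner ℝ x q.1 : ℝ) : ℂ) * Complex.I) • g (x, q.2) :=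
    funext fun q => Real.fourierInv_eq' _ _
  rw [h1]
  exact (StronglyMeasurable.integral_prod_right' (ν := volume) hk).measurable

theorem lintegral_prod_swap {f : E n × E n → ℂ} (hf : Measurable f) :
    ∫⁻ q, ‖f q‖ₑ ^ 2 = ∫⁻ w, ∫⁻ s, ‖f (s, w)‖ₑ ^ 2 :=
  lintegral_prod_symm _ (hf.enorm.pow_const 2).aemeasurable

theorem weylKernelFun_eq_comp (g : E n × E n → ℂ) :
    weylKernelFun g = fun p => partialFourierInv g (weylCoord p) :=
  funext fun p => weylKernelFun_eq_fourierInv g p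

/-- After the change of variables, Tonelli reduces the identity to Plancherel on almost every slice
with fixed second variable. -/
theorem lintegral_enorm_sq_weylKernelFun_of_sections {f : E n × E n → ℂ}
    (hf : StronglyMeasurable f) (h2 : ∀ᵐ w, Integrable fun x => f (x, w))
    (h3 : ∀ᵐ w, MemLp (fun x => f (x, w)) 2) :
    ∫⁻ p, ‖weylKernelFun f p‖ₑ ^ 2 = ∫⁻ p, ‖f p‖ₑ ^ 2 := by
  have hP := measurable_partialFourierInv hf
  have h1 := measurePreserving_weylCoord.lintegral_comp (hP.enorm.pow_const 2)
  rw [weylKernelFun_eq_comp, h1, lintegral_prod_swap hP, lintegral_prod_swap hf.measurable]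
  refine lintegral_congr_ae ?_
  filter_upwards [h2, h3] with w h2 h3
  simpa only [partialFourierInv] using lintegral_enorm_sq_fourierInv h2 h3

theorem lintegral_enorm_sq_weylKernelFun {g : L2 n} (hg : Integrable g) :
    ∫⁻ p, ‖weylKernelFun (g : E n × E n → ℂ) p‖ₑ ^ 2 = ∫⁻ p, ‖(g : E n × E n → ℂ) p‖ₑ ^ 2 :=
  lintegral_enorm_sq_weylKernelFun_of_sections (Lp.stronglyMeasurable g)
    (ae_integrable_section hg) (ae_memLp_section g)

theorem memLp_weylKernelFun {g : L2 n} (hg : Integrable g) :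
    MemLp (weylKernelFun (g : E n × E n → ℂ)) 2 := by
  refine ⟨(stronglyMeasurable_weylKernelFun g).aestronglyMeasurable, ?_⟩
  rw [eLpNorm_lt_top_iff_lintegral_rpow_enorm_lt_top (by norm_num) (by norm_num)]
  have h := lintegral_enorm_sq_weylKernelFun hg
  rw [← enorm_sq_eq_lintegral] at h
  have h2 : ∫⁻ p, ‖weylKernelFun (g : E n × E n → ℂ) p‖ₑ ^ 2 < ∞ := by
    rw [h]; exact ENNReal.pow_lt_top enorm_lt_top
  simpa using h2

theorem norm_toL2_weylKernelFun {g : L2 n} (hg : Integrable g) :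
    ‖toL2 volume (weylKernelFun (g : E n × E n → ℂ))‖ = ‖g‖ := by
  have h := enorm_sq_toL2 (memLp_weylKernelFun hg)
  rw [lintegral_enorm_sq_weylKernelFun hg, ← enorm_sq_eq_lintegral] at h
  have h2 : ‖toL2 volume (weylKernelFun (g : E n × E n → ℂ))‖ₑ = ‖g‖ₑ :=
    (ENNReal.pow_right_strictMono two_ne_zero).injective h
  simpa using congrArg ENNReal.toReal h2

/-- The subspace `L¹ ∩ L²` of `L²`. -/
noncomputable def integrableSubmodule (n : ℕ) : Submodule ℂ (L2 n) where
  carrier := {g | Integrable g volume}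
  add_mem' {f g} hf hg := (Integrable.add hf hg).congr (Lp.coeFn_add f g).symm
  zero_mem' := (integrable_zero _ _ _).congr (Lp.coeFn_zero ℂ 2 _).symm
  smul_mem' c f hf := (Integrable.smul c hf).congr (Lp.coeFn_smul c f).symm

theorem integrable_mul_cis {f : E n → ℂ} (hf : Integrable f) (v : E n) :
    Integrable fun x => f x * cis (Real.pi * inner ℝ x v) := by
  refine hf.mul_bdd (c := 1) (Continuous.aestronglyMeasurable ?_)
    (Eventually.of_forall fun x => (norm_cis _).le)
  exact continuous_cis.comp (by fun_prop)

/-- The map `g ↦ K_g` on `L¹ ∩ L²`. -/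
noncomputable def weylKernelCore (n : ℕ) : integrableSubmodule n →ₗ[ℂ] L2 n where
  toFun g := toL2 volume (weylKernelFun (g : E n × E n → ℂ))
  map_add' f g := by
    rw [toL2_eq_toLp (memLp_weylKernelFun f.2), toL2_eq_toLp (memLp_weylKernelFun g.2),
      ← MemLp.toLp_add, ← toL2_eq_toLp]
    refine toL2_congr ?_
    -- Additivity of the integral needs integrable sections, which are available only for almost
    -- every `η - ξ`.
    filter_upwards [weylKernelFun_congr (Lp.coeFn_add (f : L2 n) g),
      ae_sub_of_ae (ae_integrable_section f.2), ae_sub_of_ae (ae_integrable_section g.2)]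
      with p h1 h2 h3
    refine h1.trans ?_
    simp only [weylKernelFun, Pi.add_apply, add_mul]
    exact integral_add (integrable_mul_cis h2 _) (integrable_mul_cis h3 _)
  map_smul' c f := by
    rw [RingHom.id_apply, toL2_eq_toLp (memLp_weylKernelFun f.2), ← MemLp.toLp_const_smul,
      ← toL2_eq_toLp]
    refine toL2_congr ?_
    filter_upwards [weylKernelFun_congr (Lp.coeFn_smul c (f : L2 n))] with p h1
    refine h1.trans ?_
    simp only [weylKernelFun, Pi.smul_apply, smul_eq_mul, mul_assoc]
    exact integral_const_mul _ _

theorem denseRange_subtype_integrableSubmodule :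
    DenseRange (integrableSubmodule n).subtype := by
  have h := dense_integrable (μ := (volume : Measure (E n × E n)))
  rw [DenseRange]
  convert h using 1
  exact Subtype.range_coe

/-- The Weyl kernel as an isometry of `L²(ℝ²ⁿ)`. -/
noncomputable def weylKernelLI (n : ℕ) : L2 n →ₗᵢ[ℂ] L2 n where
  toLinearMap :=
    ((weylKernelCore n).extendOfNorm (integrableSubmodule n).subtype : L2 n →L[ℂ] L2 n)
  norm_map' := by
    have hn : ∀ g : integrableSubmodule n,
        ‖weylKernelCore n g‖ = ‖(integrableSubmodule n).subtype g‖ := fun g =>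
      norm_toL2_weylKernelFun g.2
    refine denseRange_subtype_integrableSubmodule.induction ?_
      (isClosed_eq (by fun_prop) continuous_norm)
    rintro _ ⟨g, rfl⟩
    rw [← hn g]
    exact congrArg norm (LinearMap.extendOfNorm_eq denseRange_subtype_integrableSubmodule
      ⟨1, fun x => by rw [one_mul, hn]⟩ g)

theorem weylKernelLI_of_integrable {g : L2 n} (hg : Integrable g) :
    weylKernelLI n g = toL2 volume (weylKernelFun (g : E n × E n → ℂ)) :=
  LinearMap.extendOfNorm_eq denseRange_subtype_integrableSubmodule
    ⟨1, fun x => by rw [one_mul]; exact (norm_toL2_weylKernelFun x.2).le⟩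
    (⟨g, hg⟩ : integrableSubmodule n)

/-- The isometry agrees with `g ↦ K_g` on `L¹ ∩ L²` and is continuous; density makes the filter
nontrivial, so the limit is unique. -/
theorem weylKernel_eq (φ : L2 n) : weylKernel φ = weylKernelLI n φ := by
  have hne : (𝓝[{g : L2 n | Integrable g volume}] φ).NeBot :=
    mem_closure_iff_nhdsWithin_neBot.1 (dense_integrable φ)
  refine Tendsto.limUnder_eq ?_
  refine (((weylKernelLI n).continuous.tendsto φ).mono_left nhdsWithin_le_nhds).congr' ?_
  filter_upwards [self_mem_nhdsWithin] with g hg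
  exact weylKernelLI_of_integrable hg

end WeylKernel

/-! ### Twisted translations acting on kernels. -/

section Covariance

open Filter Set
open scoped RealInnerProductSpace

variable {n : ℕ}

theorem measurePreserving_sub_latt (k l : Fin n → ℤ) :
    MeasurePreserving (fun p : E n × E n => (p.1 - latt k, p.2 - latt l)) volume volume :=
  (measurePreserving_sub_right volume (latt k : E n)).prod
    (measurePreserving_sub_right volume (latt l : E n))

theorem coeFn_twistedTranslate (k l : Fin n → ℤ) (φ : L2 n) :
    twistedTranslate k l φ =ᵐ[volume] fun p =>
      cis (Real.pi * (inner ℝ p.1 (latt l) - inner ℝ p.2 (latt k))) *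
        φ (p.1 - latt k, p.2 - latt l) :=
  (memLp_twistedTranslate k l φ).coeFn_toLp

theorem continuous_twistedTranslate (k l : Fin n → ℤ) :
    Continuous (twistedTranslate (n := n) k l) := by
  let M := mulLI (μ := (volume : Measure (E n × E n)))
    (fun p => cis (Real.pi * (inner ℝ p.1 (latt l) - inner ℝ p.2 (latt k))))
    (continuous_cis.comp (by fun_prop)).aestronglyMeasurable fun _ => norm_cis _
  let C : L2 n →ₗᵢ[ℂ] L2 n := Lp.compMeasurePreservingₗᵢ ℂ _ (measurePreserving_sub_latt k l)
  have h : twistedTranslate (n := n) k l = fun φ => M (C φ) := by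
    funext φ
    refine Lp.ext ?_
    filter_upwards [coeFn_twistedTranslate k l φ, coeFn_mulLI _ _ _ (C φ),
      Lp.coeFn_compMeasurePreserving φ (measurePreserving_sub_latt k l)] with p h1 h2 h3
    rw [h1, h2]
    congr 1
    exact h3.symm
  rw [h]
  exact M.continuous.comp C.continuous

theorem measurePreserving_add_latt_fst (l : Fin n → ℤ) :
    MeasurePreserving (fun p : E n × E n => (p.1 + latt l, p.2)) volume volume :=
  (measurePreserving_add_right volume (latt l : E n)).prod (MeasurePreserving.id volume)

/-- The action of the twisted translations on kernels:
`K ↦ e^{πi k·l} e^{2πi k·ξ} K(ξ + l, η)`. -/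
noncomputable def kernelShift (k l : Fin n → ℤ) : L2 n →ₗᵢ[ℂ] L2 n :=
  (mulLI (μ := (volume : Measure (E n × E n)))
    (fun p => cis (Real.pi * inner ℝ (latt k) (latt l) + 2 * Real.pi * inner ℝ (latt k) p.1))
    (continuous_cis.comp (by fun_prop)).aestronglyMeasurable fun _ => norm_cis _).comp
    (Lp.compMeasurePreservingₗᵢ ℂ _ (measurePreserving_add_latt_fst l))

theorem coeFn_kernelShift (k l : Fin n → ℤ) (K : L2 n) :
    kernelShift k l K =ᵐ[volume] fun p =>
      cis (Real.pi * inner ℝ (latt k) (latt l) + 2 * Real.pi * inner ℝ (latt k) p.1) *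
        K (p.1 + latt l, p.2) := by
  filter_upwards [coeFn_mulLI
      (fun p => cis (Real.pi * inner ℝ (latt k) (latt l) + 2 * Real.pi * inner ℝ (latt k) p.1))
      (continuous_cis.comp (by fun_prop)).aestronglyMeasurable (fun _ => norm_cis _)
      (Lp.compMeasurePreservingₗᵢ ℂ _ (measurePreserving_add_latt_fst l) K),
    Lp.coeFn_compMeasurePreserving K (measurePreserving_add_latt_fst l)] with p h1 h2
  refine h1.trans ?_
  congr 1

theorem weylKernelFun_twistedTranslate (k l : Fin n → ℤ) (φ : E n × E n → ℂ) (p : E n × E n) :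
    weylKernelFun (fun p : E n × E n =>
      cis (Real.pi * (inner ℝ p.1 (latt l) - inner ℝ p.2 (latt k))) *
        φ (p.1 - latt k, p.2 - latt l)) p =
      cis (Real.pi * inner ℝ (latt k) (latt l) + 2 * Real.pi * inner ℝ (latt k) p.1) *
        weylKernelFun φ (p.1 + latt l, p.2) := by
  rw [weylKernelFun, weylKernelFun, ← integral_const_mul]
  refine Eq.trans (integral_congr_ae (Eventually.of_forall fun x => ?_))
    (integral_sub_right_eq_self _ (latt k : E n))
  -- Phase bookkeeping for the substitution `x ↦ x - k`. The kernel argument matches since `(η - ξ)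
  -- - l = η - (ξ + l)`.
  have hphase : Real.pi * (inner ℝ x (latt l) - inner ℝ (p.2 - p.1) (latt k)) +
      Real.pi * inner ℝ x (p.1 + p.2) =
      Real.pi * inner ℝ (latt k) (latt l) + 2 * Real.pi * inner ℝ (latt k) p.1 +
        Real.pi * inner ℝ (x - latt k) (p.1 + latt l + p.2) := by
    simp only [inner_sub_left, inner_sub_right, inner_add_right, real_inner_comm (latt k)]
    ring
  have h1 := congrArg cis hphase
  rw [cis_add, cis_add _ (Real.pi * inner ℝ (x - latt k) _)] at h1
  simp only [sub_sub]
  linear_combination φ (x - latt k, p.2 - (p.1 + latt l)) * h1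

/-- The Weyl transform turns twisted translations into shifts of the kernel. -/
theorem weylKernelLI_twistedTranslate (k l : Fin n → ℤ) (φ : L2 n) :
    weylKernelLI n (twistedTranslate k l φ) = kernelShift k l (weylKernelLI n φ) := by
  have hc1 : Continuous fun φ : L2 n => weylKernelLI n (twistedTranslate k l φ) :=
    (weylKernelLI n).continuous.comp (continuous_twistedTranslate k l)
  have hc2 : Continuous fun φ : L2 n => kernelShift k l (weylKernelLI n φ) :=
    (kernelShift k l).continuous.comp (weylKernelLI n).continuous
  -- Both sides are continuous in `φ`, so the integral formula on integrable functions decides.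
  refine congrFun (Continuous.ext_on dense_integrable hc1 hc2 fun g hg => ?_) φ
  have hg' : Integrable (twistedTranslate k l g : E n × E n → ℂ) := by
    refine Integrable.congr ?_ (coeFn_twistedTranslate k l g).symm
    refine ((measurePreserving_sub_latt k l).integrable_comp_of_integrable hg).bdd_mul (c := 1)
      (Continuous.aestronglyMeasurable ?_) (Eventually.of_forall fun p => (norm_cis _).le)
    exact continuous_cis.comp (by fun_prop)
  have hK : weylKernelLI n g =ᵐ[volume] weylKernelFun (g : E n × E n → ℂ) := by
    rw [weylKernelLI_of_integrable hg, toL2_eq_toLp (memLp_weylKernelFun hg)]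
    exact MemLp.coeFn_toLp _
  refine Lp.ext ?_
  simp only [weylKernelLI_of_integrable hg', toL2_eq_toLp (memLp_weylKernelFun hg')]
  filter_upwards [(memLp_weylKernelFun hg').coeFn_toLp, coeFn_kernelShift k l (weylKernelLI n g),
    weylKernelFun_congr (coeFn_twistedTranslate k l g),
    (measurePreserving_add_latt_fst l).quasiMeasurePreserving.ae hK] with p h1 h2 h3 h4
  rw [h1, h2, h3, h4, weylKernelFun_twistedTranslate]

end Covariance

/-! ### The Zak transform as an isometry and its covariance. -/

section Zak

open Filter Set
open scoped ComplexConjugate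

variable {n : ℕ}

theorem latt_add (m l : Fin n → ℤ) : (latt (m + l) : E n) = latt m + latt l := by
  ext i; simp [latt]

theorem measurePreserving_zak_fst_snd :
    MeasurePreserving (fun z : (E n × E n) × E n => (z.1.1, z.2)) (zakMeasure n)
      ((torusMeasure n).prod volume) :=
  (measurePreserving_fst (μ := torusMeasure n) (ν := torusMeasure n)).prod
    (MeasurePreserving.id volume)

theorem ae_zak_of_ae {P : E n × E n → Prop} (h : ∀ᵐ p, P p) (m : Fin n → ℤ) :
    ∀ᵐ z ∂(zakMeasure n), P (latt m + z.1.1, z.2) := by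
  have h1 : MeasurePreserving (fun p : E n × E n => (latt m + p.1, p.2)) volume volume :=
    (measurePreserving_add_left volume (latt m : E n)).prod (MeasurePreserving.id volume)
  have h2 : ∀ᵐ p ∂((torusMeasure n).prod (volume : Measure (E n))), P (latt m + p.1, p.2) :=
    ae_mono (Measure.prod_mono Measure.restrict_le_self le_rfl)
      (h1.quasiMeasurePreserving.ae h)
  exact measurePreserving_zak_fst_snd.quasiMeasurePreserving.ae h2

theorem coeFn_zakTerm (K : L2 n) (m : Fin n → ℤ) :
    zakTerm K m =ᵐ[zakMeasure n] fun z =>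
      K (latt m + z.1.1, z.2) * cis (-(2 * Real.pi * inner ℝ (latt m) z.1.2)) :=
  (memLp_zakTerm K m).coeFn_toLp

theorem zakTerm_add (K K' : L2 n) (m : Fin n → ℤ) :
    zakTerm (K + K') m = zakTerm K m + zakTerm K' m := by
  refine Lp.ext ?_
  filter_upwards [coeFn_zakTerm (K + K') m, coeFn_zakTerm K m, coeFn_zakTerm K' m,
    Lp.coeFn_add (zakTerm K m) (zakTerm K' m), ae_zak_of_ae (Lp.coeFn_add K K') m]
    with z h1 h2 h3 h4 h5
  rw [h1, h4, Pi.add_apply, h2, h3, h5, Pi.add_apply, add_mul]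

theorem zakTerm_smul (c : ℂ) (K : L2 n) (m : Fin n → ℤ) :
    zakTerm (c • K) m = c • zakTerm K m := by
  refine Lp.ext ?_
  filter_upwards [coeFn_zakTerm (c • K) m, coeFn_zakTerm K m,
    Lp.coeFn_smul c (zakTerm K m), ae_zak_of_ae (Lp.coeFn_smul c K) m] with z h1 h2 h3 h4
  rw [h1, h3, Pi.smul_apply, h2, h4, Pi.smul_apply, smul_eq_mul, smul_eq_mul, mul_assoc]

/-- The variable `ξ'` enters only through the character of frequency `m - m' ≠ 0`, so the integral
splits off a factor of mean zero. -/
theorem inner_zakTerm (K : L2 n) {m m' : Fin n → ℤ} (h : m ≠ m') :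
    inner ℂ (zakTerm K m) (zakTerm K m') = 0 := by
  rw [← integral_inner_fiber]
  let a : E n → ℂ := fun ξ => ∫ η, conj (K (latt m + ξ, η)) * K (latt m' + ξ, η)
  have hae : (fun z => inner ℂ (fiber volume (zakTerm K m) z) (fiber volume (zakTerm K m') z))
      =ᵐ[torusMeasure₂ n] fun z => a z.1 * cis (2 * Real.pi * inner ℝ (latt (m - m')) z.2) := by
    filter_upwards [inner_fiber_ae_eq (zakTerm K m) (zakTerm K m'),
      Measure.ae_ae_of_ae_prod (coeFn_zakTerm K m),
      Measure.ae_ae_of_ae_prod (coeFn_zakTerm K m')] with z h1 h2 h3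
    rw [h1, ← integral_mul_const]
    refine integral_congr_ae ?_
    filter_upwards [h2, h3] with η h2 h3
    have hl : (latt m : E n) = latt (m - m') + latt m' := by rw [← latt_add, sub_add_cancel]
    have h4 : cis (2 * Real.pi * inner ℝ (latt m) z.2) *
        cis (-(2 * Real.pi * inner ℝ (latt m') z.2)) =
          cis (2 * Real.pi * inner ℝ (latt (m - m')) z.2) := by
      rw [← cis_add, hl, inner_add_left]
      congr 1
      ring
    rw [h2, h3, map_mul, ← cis_neg, neg_neg, ← h4]
    ring
  rw [integral_congr_ae hae,
    integral_prod_mul a fun x => cis (2 * Real.pi * inner ℝ (latt (m - m')) x),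
    integral_cis_latt (sub_ne_zero.2 h), mul_zero]

theorem measurableSet_unitCube : MeasurableSet (unitCube n) := by
  have : unitCube n = ⋂ i, (fun x : E n => x i) ⁻¹' Ico (0 : ℝ) 1 := by
    ext x; simp [unitCube]
  rw [this]
  exact MeasurableSet.iInter fun i => (by fun_prop : Measurable fun x : E n => x i) measurableSet_Ico

/-- The lattice translates of the unit cube tile the space. -/
theorem tsum_lintegral_unitCube (h : E n → ℝ≥0∞) :
    ∑' m : Fin n → ℤ, ∫⁻ ξ, h (latt m + ξ) ∂(torusMeasure n) = ∫⁻ ξ, h ξ := by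
  let T : (Fin n → ℤ) → Set (E n) := fun m => (fun x => latt m + x) '' unitCube n
  have hT : ∀ m, T m = (MeasurableEquiv.addLeft (latt m : E n)) '' unitCube n := fun m => rfl
  have hterm : ∀ m, ∫⁻ ξ, h (latt m + ξ) ∂(torusMeasure n) = ∫⁻ ξ in T m, h ξ := by
    intro m
    exact (measurePreserving_add_left volume (latt m : E n)).setLIntegral_comp_emb
      (MeasurableEquiv.addLeft (latt m : E n)).measurableEmbedding h (unitCube n)
  -- A point lies in the translate indexed by its coordinatewise integer part and in no other, which
  -- gives disjointness and covering at once.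
  have hmemT : ∀ m (x : E n), x ∈ T m ↔ ∀ i, ⌊x i⌋ = m i := by
    intro m x
    simp only [T, mem_image, unitCube, mem_ofPred_eq, mem_Ico]
    constructor
    · rintro ⟨y, hy, rfl⟩ i
      rw [Int.floor_eq_iff]
      simp only [latt, PiLp.add_apply]
      exact ⟨by linarith [(hy i).1], by linarith [(hy i).2]⟩
    · intro hx
      refine ⟨x - latt m, fun i => ?_, by abel⟩
      have := Int.floor_eq_iff.1 (hx i)
      simp only [latt, PiLp.sub_apply]
      exact ⟨by linarith [this.1], by linarith [this.2]⟩
  have hdisj : Pairwise (Function.onFun Disjoint T) := by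
    intro m m' hne
    refine disjoint_left.2 fun x hx hx' => hne (funext fun i => ?_)
    rw [← (hmemT m x).1 hx i, (hmemT m' x).1 hx' i]
  have hun : ⋃ m, T m = univ := eq_univ_of_forall fun x =>
    mem_iUnion.2 ⟨fun i => ⌊x i⌋, (hmemT _ x).2 fun _ => rfl⟩
  simp only [hterm]
  rw [← lintegral_iUnion (fun m => by
    rw [hT]; exact (MeasurableEquiv.measurableSet_image _).2 measurableSet_unitCube) hdisj, hun,
    setLIntegral_univ]

theorem tsum_enorm_sq_zakTerm (K : L2 n) : ∑' m, ‖zakTerm K m‖ₑ ^ 2 = ‖K‖ₑ ^ 2 := by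
  have hK := (Lp.stronglyMeasurable K).measurable
  have hKm : ∀ m : Fin n → ℤ, Measurable fun p : E n × E n => ‖K (latt m + p.1, p.2)‖ₑ ^ 2 :=
    fun m => (hK.comp (by fun_prop : Measurable fun p : E n × E n =>
      (latt m + p.1, p.2))).enorm.pow_const 2
  have hterm : ∀ m, ‖zakTerm K m‖ₑ ^ 2 =
      ∫⁻ ξ, (∫⁻ η, ‖K (latt m + ξ, η)‖ₑ ^ 2) ∂(torusMeasure n) := by
    intro m
    have h1 := measurePreserving_zak_fst_snd.lintegral_comp (hKm m)
    rw [lintegral_prod _ (hKm m).aemeasurable] at h1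
    rw [← h1, enorm_sq_eq_lintegral]
    refine lintegral_congr_ae ?_
    filter_upwards [coeFn_zakTerm K m] with z hz
    have h2 : ∀ θ, ‖cis θ‖ₑ = 1 := fun θ => by rw [← ofReal_norm, norm_cis, ENNReal.ofReal_one]
    rw [hz, enorm_mul, h2, mul_one]
  have hKK : ‖K‖ₑ ^ 2 = ∫⁻ ξ, ∫⁻ η, ‖K (ξ, η)‖ₑ ^ 2 := by
    rw [enorm_sq_eq_lintegral]
    exact lintegral_prod _ (hK.enorm.pow_const 2).aemeasurable
  simp only [hterm]
  rw [hKK]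
  exact tsum_lintegral_unitCube fun ξ => ∫⁻ η, ‖K (ξ, η)‖ₑ ^ 2

theorem hasSum_norm_sq_zakTerm (K : L2 n) : HasSum (fun m => ‖zakTerm K m‖ ^ 2) (‖K‖ ^ 2) := by
  have h := tsum_enorm_sq_zakTerm K
  have hne : ∑' m, ‖zakTerm K m‖ₑ ^ 2 ≠ ∞ := by
    rw [h]; exact (ENNReal.pow_lt_top enorm_lt_top).ne
  have h1 := ENNReal.hasSum_toReal hne
  rw [← ENNReal.tsum_toReal_eq fun m => ENNReal.ne_top_of_tsum_ne_top hne m, h] at h1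
  simpa [ENNReal.toReal_pow, toReal_enorm] using h1

/-- The vectors are viewed in the lines they span, an orthogonal family, where summability is
square-summability of norms. -/
theorem summable_of_pairwise_orthogonal {H ι : Type*} [NormedAddCommGroup H]
    [InnerProductSpace ℂ H] [CompleteSpace H] {x : ι → H}
    (horth : Pairwise fun i j => inner ℂ (x i) (x j) = 0) (hx : Summable fun i => ‖x i‖ ^ 2) :
    Summable x := by
  have hV : OrthogonalFamily ℂ (fun i => (Submodule.span ℂ {x i} : Submodule ℂ H))
      fun i => (Submodule.span ℂ {x i}).subtypeₗᵢ := by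
    refine OrthogonalFamily.of_pairwise fun i j hij => ?_
    change Submodule.span ℂ {x i} ⟂ Submodule.span ℂ {x j}
    rw [Submodule.isOrtho_span]
    rintro _ rfl _ rfl
    exact horth hij
  exact (hV.summable_iff_norm_sq_summable fun i =>
    ⟨x i, Submodule.mem_span_singleton_self (x i)⟩).2 hx

theorem norm_sq_tsum_of_pairwise_orthogonal {H ι : Type*} [NormedAddCommGroup H]
    [InnerProductSpace ℂ H] {x : ι → H}
    (horth : Pairwise fun i j => inner ℂ (x i) (x j) = 0) (hx : Summable x) {r : ℝ}
    (hr : HasSum (fun i => ‖x i‖ ^ 2) r) : ‖∑' i, x i‖ ^ 2 = r := by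
  have h1 : Filter.Tendsto (fun J : Finset ι => ‖∑ i ∈ J, x i‖ ^ 2) Filter.atTop
      (𝓝 (‖∑' i, x i‖ ^ 2)) := (hx.hasSum.norm).pow 2
  refine tendsto_nhds_unique h1 (hr.congr fun J => ?_)
  classical
  have : ((∑ i ∈ J, ‖x i‖ ^ 2 : ℝ) : ℂ) = ((‖∑ i ∈ J, x i‖ ^ 2 : ℝ) : ℂ) := by
    have hself : ∀ v : H, (‖v‖ : ℂ) ^ 2 = inner ℂ v v := fun v =>
      (inner_self_eq_norm_sq_to_K v).symm
    push_cast
    rw [hself, sum_inner]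
    refine Finset.sum_congr rfl fun i hi => ?_
    rw [inner_sum, Finset.sum_eq_single_of_mem i hi fun j _ hj => horth hj.symm, hself]
  exact_mod_cast this

/-- Without this, the `tsum` defining `weylZak` could be the default value 0. -/
theorem summable_zakTerm (K : L2 n) : Summable (zakTerm K) :=
  summable_of_pairwise_orthogonal (fun _ _ h => inner_zakTerm K h)
    (hasSum_norm_sq_zakTerm K).summable

/-- The Zak transform of kernels as a linear isometry. -/
noncomputable def zakLI (n : ℕ) : L2 n →ₗᵢ[ℂ] Lp ℂ 2 (zakMeasure n) where
  toFun K := ∑' m, zakTerm K m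
  map_add' K K' := by
    simp only [zakTerm_add]
    exact (summable_zakTerm K).tsum_add (summable_zakTerm K')
  map_smul' c K := by
    simp only [zakTerm_smul]
    exact (summable_zakTerm K).tsum_const_smul c
  norm_map' K := by
    have h := norm_sq_tsum_of_pairwise_orthogonal (fun _ _ h => inner_zakTerm K h)
      (summable_zakTerm K) (hasSum_norm_sq_zakTerm K)
    exact (sq_eq_sq₀ (norm_nonneg _) (norm_nonneg _)).1 h

theorem cis_two_pi_inner_latt (k m : Fin n → ℤ) :
    cis (2 * Real.pi * inner ℝ (latt k) (latt m : E n)) = 1 := by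
  have h : inner ℝ (latt k) (latt m : E n) = ((∑ i, k i * m i : ℤ) : ℝ) := by
    simp [PiLp.inner_apply, latt, mul_comm]
  rw [h, cis]
  refine Complex.exp_eq_one_iff.2 ⟨∑ i, k i * m i, ?_⟩
  push_cast
  ring

/-- The Zak transform turns kernel shifts into multiplication by characters. -/
theorem zakLI_kernelShift (k l : Fin n → ℤ) (K : L2 n) :
    zakLI n (kernelShift k l K) =ᵐ[zakMeasure n] fun z =>
      (cis (Real.pi * inner ℝ (latt k) (latt l : E n)) * char₂ (k, l) z.1) * zakLI n K z := by
  have hc : Continuous fun z : (E n × E n) × E n =>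
      cis (Real.pi * inner ℝ (latt k) (latt l : E n)) * char₂ (k, l) z.1 :=
    continuous_const.mul ((continuous_char₂ (k, l)).comp continuous_fst)
  let M := mulLI (μ := zakMeasure n) _ hc.aestronglyMeasurable
    fun z => by rw [norm_mul, norm_cis, norm_char₂, one_mul]
  -- The shift by `l` moves term `m` to `m + l`. Rewriting `e^{-2πi m·ξ'}` as `e^{2πi l·ξ'}
  -- e^{-2πi(m+l)·ξ'}` produces the second half of the character; the first half is `e^{2πi k·(m+ξ)}
  -- = e^{2πi k·ξ}`.
  have hterm : ∀ m, zakTerm (kernelShift k l K) m = M (zakTerm K (m + l)) := by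
    intro m
    refine Lp.ext ?_
    filter_upwards [coeFn_zakTerm (kernelShift k l K) m, coeFn_zakTerm K (m + l),
      coeFn_mulLI _ hc.aestronglyMeasurable
        (fun z => by rw [norm_mul, norm_cis, norm_char₂, one_mul]) (zakTerm K (m + l)),
      ae_zak_of_ae (coeFn_kernelShift k l K) m] with z h1 h2 h3 h4
    refine h1.trans (Eq.trans ?_ h3.symm)
    have hx : (latt m : E n) + z.1.1 + latt l = latt m + latt l + z.1.1 := by abel
    rw [h2, h4, latt_add, hx, char₂, inner_add_right, inner_add_left, mul_add (2 * Real.pi),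
      mul_add (2 * Real.pi), mul_add (2 * Real.pi), neg_add, cis_add, cis_add, cis_add, cis_add,
      cis_two_pi_inner_latt]
    have hl : cis (2 * Real.pi * inner ℝ (latt l) z.1.2) *
        cis (-(2 * Real.pi * inner ℝ (latt l) z.1.2)) = 1 := by
      rw [← cis_add, add_neg_cancel]
      simp [cis]
    linear_combination (-cis (Real.pi * inner ℝ (latt k) (latt l : E n)) *
      cis (2 * Real.pi * inner ℝ (latt k) z.1.1) * K (latt m + latt l + z.1.1, z.2) *
      cis (-(2 * Real.pi * inner ℝ (latt m) z.1.2))) * hl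
  have hsum : zakLI n (kernelShift k l K) = M (zakLI n K) := by
    change ∑' m, zakTerm (kernelShift k l K) m = M (∑' m, zakTerm K m)
    simp only [hterm]
    rw [← (Equiv.addRight l).tsum_eq (zakTerm K)]
    exact (M.toContinuousLinearMap.map_tsum
      ((Equiv.addRight l).summable_iff.2 (summable_zakTerm K))).symm
  rw [hsum]
  exact coeFn_mulLI _ _ _ _

end Zak

/-! ### Assembly. -/

section Main

variable {n : ℕ}

/-- The Weyl-Zak transform as a linear isometry. -/
noncomputable def weylZakLI (n : ℕ) : L2 n →ₗᵢ[ℂ] Lp ℂ 2 (zakMeasure n) :=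
  (zakLI n).comp (weylKernelLI n)

theorem weylZak_eq (φ : L2 n) : weylZak φ = weylZakLI n φ := by
  rw [weylZak, weylKernel_eq]; rfl

theorem fiberMap_eq (φ : L2 n) (z : E n × E n) :
    fiberMap φ z = fiber volume (weylZakLI n φ) z := by
  rw [fiberMap, weylZak_eq]; rfl

theorem isModulationSystem_weylZak (φ : ℤ → L2 n) :
    IsModulationSystem (μ := torusMeasure₂ n) (ν := (volume : Measure (E n))) char₂
      (fun q => cis (Real.pi * inner ℝ (latt q.1) (latt q.2 : E n)))
      (fun s => weylZakLI n (φ s))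
      fun i => weylZakLI n (twistedTranslate i.1.1 i.1.2 (φ i.2)) where
  norm_phase _ := norm_cis _
  parseval _ hg := tsum_enorm_sq_integral_char₂ hg
  ae_eq q s := by
    have h := zakLI_kernelShift q.1 q.2 (weylKernelLI n (φ s))
    rw [← weylKernelLI_twistedTranslate] at h
    exact h

end Main

end TwistedShift

theorem mainTheorem10 (n : ℕ) (φ : ℤ → TwistedShift.L2 n) (A B : ℝ) :
    TwistedShift.IsFrameSequence A B (TwistedShift.twistedSystem φ) ↔
      ∀ᵐ z ∂(TwistedShift.torusMeasure₂ n),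
        TwistedShift.IsFrameSequence A B (fun s : ℤ => TwistedShift.fiberMap (φ s) z) := by
  open TwistedShift in
  simp only [fiberMap_eq]
  -- The fiber condition becomes one on the modulated system; the isometry carries the twisted
  -- system onto it, and the associator matches the index `(k, l, s)` with `((k, l), s)`.
  rw [← (isModulationSystem_weylZak φ).isFrameSequence_iff_fibers,
    ← isFrameSequence_comp_linearIsometry (weylZakLI n),
    ← isFrameSequence_comp_equiv (Equiv.prodAssoc (Fin n → ℤ) (Fin n → ℤ) ℤ)]
  rfl
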